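/- Let $k_1,k_2\ge 1$ be integers with $k_1+k_2<n$ and let $\delta>0$. Let $G(n,k)$ and $A(n,k)$ be the spaces of $k$-dimensional linear and affine subspaces of $\mathbb R^n$, with their usual topologies and Borel $\sigma$-algebras. A $k$-flat process $X$ is a random locally finite set of $k$-flats (a simple point process on $A(n,k)$) whose intensity measure $\Theta(\cdot)=\mathbb E X(\cdot)$ is locally finite; it is weakly stationary if $\Theta$ is invariant under translations. In that case its intensity is $\gamma=\kappa_{n-k}^{-1}\,\mathbb E X(\{E:E\cap B^n\ne\emptyset\})$, where $B^n$ is the unit ball of $\mathbb R^n$ and $\kappa_{n-k}$ is the volume of the $(n-k)$-dimensional unit ball, and (if $\gamma>0$) its directional distribution is the probability measure $\mathbb Q$ on $G(n,k)$ given by $$\mathbb Q(D)=\frac{\mathbb E X(\{E:E\cap B^n\neq\emptyset,\ L(E)\in D\})}{\mathbb E X(\{E:E\cap B^n\neq\emptyset\})},$$ where $L(E)$ is the linear subspace parallel to $E$. (If $\gamma=0$, put $\mathbb Q=0$.) Let $X_1$ be a weakly stationary $k_1$-flat process and $X_2$ a weakly stationary $k_2$-flat process in $\mathbb R^n$, with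 intensities $\gamma_1,\gamma_2$ and directional distributions $\mathbb Q_1,\mathbb Q_2$, and suppose that $X_1$ and $X_2$ are independent. For $E\in A(n,k_1)$ and $F\in A(n,k_2)$ in general position, that is, $\dim(L(E)+L(F))=k_1+k_2$, let $x_E\in E$ and $x_F\in F$ be the unique points with $\|x_E-x_F\|=d(E,F):=\inf\{\|x-y\|:x\in E,\ y\in F\}$, let $m(E,F)=(x_E+x_F)/2$ and let $\phi(E,F)$ be the linear span of $x_E-x_F$. The proximity process of $X_1$ and $X_2$ with distance threshold $\delta$ is formed by the segments $\overline{x_Ex_F}$ of all pairs $E\in X_1$, $F\in X_2$ that are disjoint, in general position and satisfy $d(E,F)\le\delta$; it is regarded as the random measure $\Phi$ on $\mathbb R^n\times(0,\delta]\times\mathbb S^{n-1}$ with $$\Phi(A\times B\times C)=\sum_{(E,F)}\mathbf 1\{m(E,F)\in A,\ d(E,F)\in B\}\ \tfrac12\,\#(\phi(E,F)\cap C),$$ where the sum runs over these pairs. Let $\Lambda=\mathbb E\Phi$ be its intensity measure. Then $\Phi$ is measurable, and the following holds. (a) For all Borel sets $A\subset\mathbb R^n$, $B\subset(0,\delta]$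 and $C\subset\mathbb S^{n-1}$, $$\Lambda(A\times B\times C)=\gamma_1\gamma_2\,\ell(A)\int_B t^{\,n-k_1-k_2-1}\,dt\int_{G(n,k_1)}\int_{G(n,k_2)}\sigma_{(L+M)^\perp}\big(C\cap(L+M)^\perp\big)\,[L,M]\,\mathbb Q_2(dM)\,\mathbb Q_1(dL).$$ Here $\ell$ is Lebesgue measure, $\sigma_U$ is the spherical Lebesgue measure on the unit sphere of the linear subspace $U$, and $[L,M]$ is the $(k_1+k_2)$-dimensional volume of the parallelepiped spanned by an orthonormal basis of $L$ together with an orthonormal basis of $M$. (In $[0,\infty]$ the convention $0\cdot\infty=0$ is used.) (b) The process is weakly stationary: $\Lambda$ is invariant under translations of its first argument. (c) If $\mathbb Q_1$ and $\mathbb Q_2$ are invariant under rotations (elements of $SO(n)$), then $\Lambda$ is invariant under rotations of its third argument. -/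

import Mathlib

open MeasureTheory ProbabilityTheory Set
open scoped ENNReal Pointwise

noncomputable section

/-- Euclidean `n`-space. -/
abbrev Euc (n : ℕ) : Type := EuclideanSpace ℝ (Fin n)

/-- The unit sphere of Euclidean `n`-space. -/
abbrev EucSphere (n : ℕ) : Type := Metric.sphere (0 : Euc n) 1

/-! ### Grassmannians and spaces of flats -/

/-- `G(n,k)`: the `k`-dimensional linear subspaces of `ℝⁿ`. -/
def Gr (n k : ℕ) : Type := {L : Submodule ℝ (Euc n) // Module.finrank ℝ L = k}

/-- `A(n,k)`: the `k`-dimensional (non-empty) affine subspaces of `ℝⁿ`. -/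
def Flat (n k : ℕ) : Type :=
  {F : AffineSubspace ℝ (Euc n) // (F : Set (Euc n)).Nonempty ∧ Module.finrank ℝ F.direction = k}

/-- The point of the flat `F` closest to the origin. -/
def Flat.foot {n k : ℕ} (F : Flat n k) : Euc n :=
  haveI : Nonempty F.1 := F.2.1.to_subtype
  (EuclideanGeometry.orthogonalProjection F.1 0 : Euc n)

/-- The usual topology of `G(n,k)`: a subspace is identified with the orthogonal projection
onto it. -/
instance Gr.instTopologicalSpace (n k : ℕ) : TopologicalSpace (Gr n k) :=
  TopologicalSpace.induced (fun L : Gr n k => (L.1.starProjection : Euc n →L[ℝ] Euc n))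
    inferInstance

/-- The usual topology of `A(n,k)`: a flat is identified with the pair consisting of the
orthogonal projection onto its direction space and its point closest to the origin. -/
instance Flat.instTopologicalSpace (n k : ℕ) : TopologicalSpace (Flat n k) :=
  TopologicalSpace.induced
    (fun F : Flat n k => ((F.1.direction.starProjection : Euc n →L[ℝ] Euc n), F.foot))
    inferInstance

instance Gr.instMeasurableSpace (n k : ℕ) : MeasurableSpace (Gr n k) := borel _
instance Gr.instBorelSpace (n k : ℕ) : BorelSpace (Gr n k) := ⟨rfl⟩
instance Flat.instMeasurableSpace (n k : ℕ) : MeasurableSpace (Flat n k) := borel _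
instance Flat.instBorelSpace (n k : ℕ) : BorelSpace (Flat n k) := ⟨rfl⟩

/-- The linear subspace parallel to a flat. -/
def Flat.dir {n k : ℕ} (F : Flat n k) : Gr n k := ⟨F.1.direction, F.2.2⟩

/-- The translate `F + z` of a flat. -/
def Flat.translate {n k : ℕ} (z : Euc n) (F : Flat n k) : Flat n k :=
  ⟨z +ᵥ F.1, by
    obtain ⟨x, hx⟩ := F.2.1
    exact ⟨z +ᵥ x, AffineSubspace.vadd_mem_pointwise_vadd_iff.2 hx⟩, by
    rw [AffineSubspace.pointwise_vadd_direction]; exact F.2.2⟩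

/-- The image of a linear subspace under a linear isometry of `ℝⁿ`. -/
def Gr.rotate {n k : ℕ} (ρ : Euc n ≃ₗᵢ[ℝ] Euc n) (L : Gr n k) : Gr n k :=
  ⟨L.1.map (ρ.toLinearEquiv : Euc n →ₗ[ℝ] Euc n), by
    rw [LinearEquiv.finrank_map_eq]; exact L.2⟩

/-- The action of a linear isometry of `ℝⁿ` on the unit sphere. -/
def rotateSphere {n : ℕ} (ρ : Euc n ≃ₗᵢ[ℝ] Euc n) (u : EucSphere n) : EucSphere n :=
  ⟨ρ u, by simp⟩

/-- The flats that meet a given set. -/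
def Flat.hitting (n k : ℕ) (C : Set (Euc n)) : Set (Flat n k) :=
  {F | ((F.1 : Set (Euc n)) ∩ C).Nonempty}

/-! ### Flat processes -/

/-- The counting measure `∑_{x ∈ S} δ_x` of a set `S`. -/
def countingMeasure {α : Type*} [MeasurableSpace α] (S : Set α) : Measure α :=
  Measure.sum fun x : S => Measure.dirac (x : α)

/-- A `k`-flat process in `ℝⁿ` over the probability space `(Ω, P)`: a random locally finite set of
`k`-flats, such that the associated random counting measure is measurable (for the `σ`-algebra on
measures generated by the evaluations) and has a locally finite intensity measure. -/
structure FlatProcess (n k : ℕ) {Ω : Type*} [MeasurableSpace Ω] (P : Measure Ω) where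
  /-- the flats of the process -/
  flats : Ω → Set (Flat n k)
  locallyFinite : ∀ ω, ∀ C : Set (Euc n), IsCompact C →
    (flats ω ∩ Flat.hitting n k C).Finite
  measurable_countingMeasure : Measurable fun ω => countingMeasure (flats ω)
  intensity_lt_top : ∀ C : Set (Euc n), IsCompact C →
    ∫⁻ ω, countingMeasure (flats ω) (Flat.hitting n k C) ∂P < ∞

namespace FlatProcess

variable {n k : ℕ} {Ω : Type*} [MeasurableSpace Ω] {P : Measure Ω}

/-- The process as a random counting measure. -/
def randomMeasure (X : FlatProcess n k P) (ω : Ω) : Measure (Flat n k) :=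
  countingMeasure (X.flats ω)

/-- The intensity measure `Θ(A) = 𝔼 X(A)`. -/
def intensityMeasure (X : FlatProcess n k P) : Measure (Flat n k) := P.bind X.randomMeasure

/-- Weak stationarity: the intensity measure is translation invariant. -/
def IsWeaklyStationary (X : FlatProcess n k P) : Prop :=
  ∀ z : Euc n, X.intensityMeasure.map (Flat.translate z) = X.intensityMeasure

/-- The intensity `γ = κ_{n-k}⁻¹ 𝔼 X({E : E ∩ Bⁿ ≠ ∅})`, where `κ_{n-k}` is the volume of the
`(n-k)`-dimensional unit ball. -/
def intensity (X : FlatProcess n k P) : ℝ≥0∞ :=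
  X.intensityMeasure (Flat.hitting n k (Metric.closedBall 0 1)) /
    volume (Metric.closedBall (0 : Euc (n - k)) 1)

/-- The directional distribution
`Q(A) = 𝔼 X({E : E ∩ Bⁿ ≠ ∅, L(E) ∈ A}) / 𝔼 X({E : E ∩ Bⁿ ≠ ∅})`
(the zero measure if the intensity vanishes). -/
def directionalDistribution (X : FlatProcess n k P) : Measure (Gr n k) :=
  (cond X.intensityMeasure (Flat.hitting n k (Metric.closedBall 0 1))).map Flat.dir

end FlatProcess

/-- Rotation invariance of a measure on `G(n,k)`. -/
def IsRotationInvariant {n k : ℕ} (Q : Measure (Gr n k)) : Prop :=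
  ∀ ρ : Euc n ≃ₗᵢ[ℝ] Euc n, LinearMap.det (ρ.toLinearEquiv : Euc n →ₗ[ℝ] Euc n) = 1 →
    Q.map (Gr.rotate ρ) = Q

/-! ### Subspace determinant and spherical Lebesgue measure -/

/-- The subspace determinant `[L, M]` (for `dim L + dim M ≤ n`): the volume of the parallelepiped
spanned by an orthonormal basis of `L` together with an orthonormal basis of `M`, that is, the
square root of the Gram determinant of these vectors. -/
def subspaceDet {n : ℕ} (L M : Submodule ℝ (Euc n)) : ℝ :=
  Real.sqrt (Matrix.gram ℝ (Sum.elim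
    (fun i => (stdOrthonormalBasis ℝ L i : Euc n))
    (fun j => (stdOrthonormalBasis ℝ M j : Euc n)))).det

/-- The inclusion of the unit sphere of a linear subspace `U` into the unit sphere of `ℝⁿ`. -/
def sphereInclusion {n : ℕ} (U : Submodule ℝ (Euc n)) (u : Metric.sphere (0 : U) 1) :
    EucSphere n :=
  ⟨((u : U) : Euc n), mem_sphere_zero_iff_norm.2 (mem_sphere_zero_iff_norm.1 u.2)⟩

/-- `σ_U(C ∩ U)`: the spherical Lebesgue measure, on the unit sphere of the linear subspace `U`, of
the part of `C` in `U`. -/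
def sphericalMeasure {n : ℕ} (U : Submodule ℝ (Euc n)) (C : Set (EucSphere n)) : ℝ≥0∞ :=
  (volume : Measure U).toSphere (sphereInclusion U ⁻¹' C)

/-! ### The orthogonal segment of two flats and the proximity process -/

section Segment

variable {n k₁ k₂ : ℕ}

/-- Two flats with `k₁ + k₂ ≤ n` are in general position if the sum of their direction spaces has
dimension `k₁ + k₂`. -/
def InGeneralPosition (E : Flat n k₁) (F : Flat n k₂) : Prop :=
  Module.finrank ℝ (E.1.direction ⊔ F.1.direction : Submodule ℝ (Euc n)) = k₁ + k₂

/-- The distance `d(E, F) = inf {‖x - y‖ : x ∈ E, y ∈ F}`. -/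
def flatDist (E : Flat n k₁) (F : Flat n k₂) : ℝ :=
  sInf (image2 dist (E.1 : Set (Euc n)) (F.1 : Set (Euc n)))

/-- `p = (x_E, x_F)` is a pair of points of `E` and `F` that realizes the distance. -/
def IsClosestPair (E : Flat n k₁) (F : Flat n k₂) (p : Euc n × Euc n) : Prop :=
  p.1 ∈ E.1 ∧ p.2 ∈ F.1 ∧ dist p.1 p.2 = flatDist E F

/-- For flats in general position the closest pair exists and is unique. -/
theorem existsUnique_isClosestPair (E : Flat n k₁) (F : Flat n k₂) (h : InGeneralPosition E F) :
    ∃! p, IsClosestPair E F p := by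
  obtain ⟨a, ha⟩ := E.2.1
  obtain ⟨b, hb⟩ := F.2.1
  set L := E.1.direction with hL
  set M := F.1.direction with hM
  have hLM : L ⊓ M = ⊥ := by
    have h1 := Submodule.finrank_sup_add_finrank_inf_eq L M
    have h2 : Module.finrank ℝ L = k₁ := E.2.2
    have h3 : Module.finrank ℝ M = k₂ := F.2.2
    have h4 : Module.finrank ℝ (L ⊔ M : Submodule ℝ (Euc n)) = k₁ + k₂ := h
    have h5 : Module.finrank ℝ (L ⊓ M : Submodule ℝ (Euc n)) = 0 := by omega
    exact Submodule.finrank_eq_zero.1 h5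
  obtain ⟨l, hl, m, hm, hlm⟩ :=
    Submodule.mem_sup.1 ((L ⊔ M).starProjection_apply_mem (a - b))
  have hx : a - l ∈ E.1 := by
    have := AffineSubspace.vadd_mem_of_mem_direction (L.neg_mem hl) ha
    simpa [sub_eq_add_neg, add_comm] using this
  have hy : b + m ∈ F.1 := by
    have := AffineSubspace.vadd_mem_of_mem_direction hm hb
    simpa [add_comm] using this
  have horth : ∀ w ∈ L ⊔ M, inner ℝ ((a - l) - (b + m)) w = 0 := by
    intro w hw
    have h1 := (L ⊔ M).sub_starProjection_mem_orthogonal (a - b)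
    have h2 : (a - l) - (b + m) = (a - b) - (L ⊔ M).starProjection (a - b) := by
      rw [← hlm]; abel
    rw [h2, real_inner_comm]
    exact (Submodule.mem_orthogonal _ _).1 h1 w hw
  have key : ∀ x ∈ E.1, ∀ y ∈ F.1, ∃ w₁ ∈ L, ∃ w₂ ∈ M, x = (a - l) + w₁ ∧ y = (b + m) + w₂ ∧
      ‖x - y‖ ^ 2 = ‖(a - l) - (b + m)‖ ^ 2 + ‖w₁ - w₂‖ ^ 2 := by
    intro x hxE y hyF
    have h1 : x - (a - l) ∈ L := AffineSubspace.vsub_mem_direction hxE hx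
    have h2 : y - (b + m) ∈ M := AffineSubspace.vsub_mem_direction hyF hy
    refine ⟨_, h1, _, h2, by abel, by abel, ?_⟩
    have h3 : x - y = ((a - l) - (b + m)) + ((x - (a - l)) - (y - (b + m))) := by abel
    conv_lhs => rw [h3]
    rw [norm_add_sq_real, horth _ (Submodule.sub_mem _ (Submodule.mem_sup_left h1)
      (Submodule.mem_sup_right h2))]
    ring
  have hdist : dist (a - l) (b + m) = flatDist E F := by
    have : IsLeast (image2 dist (E.1 : Set (Euc n)) (F.1 : Set (Euc n)))
        (dist (a - l) (b + m)) := by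
      refine ⟨⟨_, hx, _, hy, rfl⟩, ?_⟩
      rintro _ ⟨x, hxE, y, hyF, rfl⟩
      obtain ⟨w₁, -, w₂, -, -, -, hn⟩ := key x hxE y hyF
      rw [dist_eq_norm, dist_eq_norm]
      exact le_of_sq_le_sq (by nlinarith [sq_nonneg ‖w₁ - w₂‖]) (norm_nonneg _)
    exact this.csInf_eq.symm
  refine ⟨(a - l, b + m), ⟨hx, hy, hdist⟩, ?_⟩
  rintro ⟨x, y⟩ ⟨hxE, hyF, hd⟩
  obtain ⟨w₁, hw₁, w₂, hw₂, rfl, rfl, hn⟩ := key x hxE y hyF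
  rw [← hdist, dist_eq_norm, dist_eq_norm] at hd
  simp only at hd
  rw [hd] at hn
  have h0 : w₁ - w₂ = 0 := by
    have : ‖w₁ - w₂‖ ^ 2 = 0 := by linarith
    exact norm_eq_zero.1 (pow_eq_zero_iff (two_ne_zero) |>.1 this)
  have h1 : w₁ = w₂ := sub_eq_zero.1 h0
  subst h1
  have h2 : w₁ = 0 := (Submodule.mem_bot ℝ).1 (hLM ▸ Submodule.mem_inf.2 ⟨hw₁, hw₂⟩)
  simp [h2]

/-- The endpoints `(x_E, x_F)` of the orthogonal segment of two flats in general position. -/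
def closestPair (E : Flat n k₁) (F : Flat n k₂) : Euc n × Euc n :=
  Classical.epsilon (IsClosestPair E F)

/-- The midpoint `m(E, F)` of the orthogonal segment. -/
def segMidpoint (E : Flat n k₁) (F : Flat n k₂) : Euc n :=
  midpoint ℝ (closestPair E F).1 (closestPair E F).2

/-- The length of the orthogonal segment. -/
def segLength (E : Flat n k₁) (F : Flat n k₂) : ℝ :=
  dist (closestPair E F).1 (closestPair E F).2

/-- The direction `φ(E, F)` of the orthogonal segment, a linear subspace (a line if `E` and `F` are
disjoint). -/
def segDirection (E : Flat n k₁) (F : Flat n k₂) : Submodule ℝ (Euc n) :=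
  Submodule.span ℝ {(closestPair E F).1 - (closestPair E F).2}

/-- The measure `A × B × C ↦ 𝟙{(m, d) ∈ A × B} ½ ℋ⁰(φ ∩ C)` on `ℝⁿ × ℝ × 𝕊ⁿ⁻¹` of the orthogonal
segment of `E` and `F`, with midpoint `m`, length `d` and direction `φ`. -/
def segMeasure (E : Flat n k₁) (F : Flat n k₂) : Measure (Euc n × ℝ × EucSphere n) :=
  ((2⁻¹ : ℝ≥0∞) • Measure.count.restrict {u : EucSphere n | (u : Euc n) ∈ segDirection E F}).map
    fun u => (segMidpoint E F, segLength E F, u)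

variable {Ω : Type*} [MeasurableSpace Ω] {P : Measure Ω}

/-- The pairs of flats that contribute a segment to the proximity process with distance threshold
`δ`: disjoint, in general position and at distance at most `δ`. -/
def proximityPairs (X₁ : FlatProcess n k₁ P) (X₂ : FlatProcess n k₂ P) (δ : ℝ) (ω : Ω) :
    Set (Flat n k₁ × Flat n k₂) :=
  {p | p.1 ∈ X₁.flats ω ∧ p.2 ∈ X₂.flats ω ∧ Disjoint (p.1.1 : Set (Euc n)) (p.2.1 : Set (Euc n)) ∧
    InGeneralPosition p.1 p.2 ∧ flatDist p.1 p.2 ≤ δ}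

/-- The proximity process of `X₁` and `X₂` with distance threshold `δ`, as a random measure on
`ℝⁿ × ℝ × 𝕊ⁿ⁻¹` (midpoint, length, direction), symmetric in the third component. -/
def proximityProcess (X₁ : FlatProcess n k₁ P) (X₂ : FlatProcess n k₂ P) (δ : ℝ) (ω : Ω) :
    Measure (Euc n × ℝ × EucSphere n) :=
  Measure.sum fun p : proximityPairs X₁ X₂ δ ω => segMeasure p.1.1 p.1.2

/-- The intensity measure `Λ` of the proximity process. -/
def proximityIntensity (X₁ : FlatProcess n k₁ P) (X₂ : FlatProcess n k₂ P) (δ : ℝ) :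
    Measure (Euc n × ℝ × EucSphere n) :=
  P.bind (proximityProcess X₁ X₂ δ)

end Segment

end

/-!
The formula is proved for an arbitrary measurable set `s` of triples (midpoint, length, direction)
in place of a rectangle `A × B × C`; parts (a), (b) and (c) are then read off.

*Campbell's formula.* The mass that the segment of a pair `(E, F)` gives to `s` is a measurable
function `pairWeight` of the pair, and the proximity process integrates it with respect to
`X₁ ⊗ X₂` (`proximityProcess_apply`). This gives the measurability of the process, and by
independence its intensity measure is the integral of `pairWeight` against the product
`Θ₁ ⊗ Θ₂` of the intensity measures (`proximityIntensity_apply`).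

*Measurability of the closest pair.* The closest points of `E` and `F`, with direction spaces `L`
and `M`, are obtained by solving `(P_L + P_M) t = x` modulo `(L + M)ᗮ`. The solution is a limit of
`(P_L + P_M + ε)⁻¹ x` as `ε ↓ 0`, and these vectors depend continuously on `L` and `M`
(`tendsto_starProjection_regInv`, `measurable_nearPair`). The same regularization shows that
general position is a Borel condition (`measurableSet_disjoint`).

*Disintegration.* A translation invariant, locally finite measure on the space of `k`-flats is, up
to the intensity, the distribution of `L + z` with `L` chosen by the directional distribution and
`z` by Lebesgue measure on `Lᗮ`. This needs no general theorem on disintegrations: it follows from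
Tonelli's theorem applied to the weight `𝟙{F + z meets the unit ball}` and the translation
invariance (`lintegral_flat_eq`). To avoid integrals over the varying space `Lᗮ`, the point `z`
ranges over all of `ℝⁿ`, weighted with the indicator `cylInd L z` of `‖P_L z‖ ≤ 1`, whose integral
along `L` is the constant `κ_k`.

*Change of variables.* For fixed `L` and `M` in general position, the flats `L + z` and `M + z'`
are parametrized by `z = m + w/2 + l` and `z' = m - w/2 + l'` with `w ∈ (L + M)ᗮ`, `l ∈ L`,
`l' ∈ M`. Then `m` is the midpoint and `w` the connecting vector of the closest pair, and the
Jacobian is the Gram determinant `[L, M]` (`lintegral_lintegral_eq_shear`). If `L` and `M` are not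
in general position, both the weight and `[L, M]` vanish. The outcome is `proximityIntensity_eq`:
`Λ(s)` is `γ₁ γ₂` times the integral over `L` and `M` of `[L, M]` times the integral of the segment
mass over `m ∈ ℝⁿ` and `w ∈ (L + M)ᗮ` (`segIntegral`).

On a rectangle, polar coordinates in `(L + M)ᗮ` give (a) (`segIntegral_prod`). Translation
invariance of Lebesgue measure in `m` gives (b) (`segIntegral_translate`), and rotating the set `s`
amounts to rotating `L` and `M`, which gives (c) (`segIntegral_rotate`).
-/

noncomputable section

/-! ### Linear changes of variables -/

section

open Module

/-- The Haar measure normalized on the parallelepiped of a basis `v` differs from the Lebesgue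
measure by the volume of that parallelepiped, the square root of the Gram determinant of `v`. -/
theorem volume_eq_smul_basis_addHaar {ι E : Type*} [Fintype ι] [DecidableEq ι]
    [NormedAddCommGroup E] [InnerProductSpace ℝ E] [FiniteDimensional ℝ E] [MeasurableSpace E]
    [BorelSpace E] (v : Basis ι ℝ E) :
    (volume : Measure E) = ENNReal.ofReal (Real.sqrt (Matrix.gram ℝ v).det) • v.addHaar := by
  have hcard : finrank ℝ E = Fintype.card ι := finrank_eq_card_basis v
  let b : OrthonormalBasis ι ℝ E := (stdOrthonormalBasis ℝ E).reindex
    ((finCongr hcard).trans (Fintype.equivFin ι).symm)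
  have h1 := Measure.addHaarMeasure_unique (volume : Measure E) v.parallelepiped
  rw [← Basis.addHaar_def, Basis.coe_parallelepiped] at h1
  rw [h1]
  congr 1
  rw [← b.addHaar_eq_volume, Measure.addHaar_parallelepiped, Matrix.gram_eq_conjTranspose_mul b]
  congr 1
  rw [Matrix.det_mul, Matrix.det_conjTranspose, star_trivial, Real.sqrt_mul_self_eq_abs]
  rfl

variable {n : ℕ} (L M : Submodule ℝ (Euc n))

/-- The linear map `(w, l, m) ↦ w + l + m` from `(L + M)ᗮ × L × M` to `ℝⁿ`. -/
def sumMap : ((L ⊔ M)ᗮ : Submodule ℝ (Euc n)) × L × M →ₗ[ℝ] Euc n :=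
  ((L ⊔ M)ᗮ).subtype.coprod (L.subtype.coprod M.subtype)

variable {L M}

theorem sumMap_bijective (h : Disjoint L M) : Function.Bijective (sumMap L M) := by
  have hinj : Function.Injective (sumMap L M) := by
    rw [injective_iff_map_eq_zero]
    rintro ⟨⟨w, hw⟩, ⟨l, hl⟩, ⟨m, hm⟩⟩ h0
    have h0' : w + (l + m) = 0 := h0
    have hlm : l + m ∈ L ⊔ M := Submodule.add_mem_sup hl hm
    have hw0 : w = 0 := by
      have : w ∈ L ⊔ M := by
        rw [eq_neg_of_add_eq_zero_left h0']; exact Submodule.neg_mem _ hlm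
      exact (Submodule.disjoint_def.1 (L ⊔ M).orthogonal_disjoint) w this hw
    subst hw0
    have h1 : l = -m := by simpa using eq_neg_of_add_eq_zero_left (by simpa using h0')
    have hl0 : l = 0 := (Submodule.disjoint_def.1 h) l hl (h1 ▸ Submodule.neg_mem _ hm)
    have hm0 : m = 0 := by simpa [hl0] using h0'
    subst hl0 hm0; rfl
  have hf : finrank ℝ (((L ⊔ M)ᗮ : Submodule ℝ (Euc n)) × L × M) = finrank ℝ (Euc n) := by
    have h1 := (L ⊔ M).finrank_add_finrank_orthogonal
    have h2 := Submodule.finrank_sup_add_finrank_inf_eq L M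
    rw [h.eq_bot, finrank_bot] at h2
    simp only [finrank_prod]
    omega
  exact ⟨hinj, (LinearMap.injective_iff_surjective_of_finrank_eq_finrank hf).1 hinj⟩

/-- The subspace determinant `[L, M]` is the Jacobian of `sumMap L M`: orthonormal bases of
`(L + M)ᗮ`, `L` and `M` together form a basis of `ℝⁿ` whose Gram matrix is block diagonal, with an
identity block and the block that defines `[L, M]`. -/
theorem volume_eq_subspaceDet_smul_map (h : Disjoint L M) :
    (volume : Measure (Euc n)) = ENNReal.ofReal (subspaceDet L M) •
      (volume : Measure (((L ⊔ M)ᗮ : Submodule ℝ (Euc n)) × L × M)).map (sumMap L M) := by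
  let T : (((L ⊔ M)ᗮ : Submodule ℝ (Euc n)) × L × M) ≃ₗ[ℝ] Euc n :=
    LinearEquiv.ofBijective _ (sumMap_bijective h)
  let bU := stdOrthonormalBasis ℝ ((L ⊔ M)ᗮ : Submodule ℝ (Euc n))
  let bL := stdOrthonormalBasis ℝ L
  let bM := stdOrthonormalBasis ℝ M
  let B := bU.toBasis.prod (bL.toBasis.prod bM.toBasis)
  have hB : (volume : Measure (((L ⊔ M)ᗮ : Submodule ℝ (Euc n)) × L × M)) = B.addHaar := by
    rw [Basis.prod_addHaar, Basis.prod_addHaar, bU.addHaar_eq_volume, bL.addHaar_eq_volume,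
      bM.addHaar_eq_volume]
    rfl
  have hmap : (volume : Measure (((L ⊔ M)ᗮ : Submodule ℝ (Euc n)) × L × M)).map (sumMap L M)
      = (B.map T).addHaar := by
    rw [hB]
    exact Basis.map_addHaar B T.toContinuousLinearEquiv
  rw [hmap, volume_eq_smul_basis_addHaar (B.map T)]
  congr 3
  have hgram : Matrix.gram ℝ (B.map T) = Matrix.fromBlocks 1 0 0 (Matrix.gram ℝ (Sum.elim
      (fun i => (bL i : Euc n)) (fun j => (bM j : Euc n)))) := by
    have hU : ∀ i, (B.map T) (Sum.inl i) = bU i := by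
      intro i; simp [B, T, sumMap]
    have hR : ∀ i, (B.map T) (Sum.inr i) = Sum.elim
      (fun i => (bL i : Euc n)) (fun j => (bM j : Euc n)) i := by
      rintro (i | i) <;> simp [B, T, sumMap]
    have hmem : ∀ i, Sum.elim
      (fun i => (bL i : Euc n)) (fun j => (bM j : Euc n)) i ∈ L ⊔ M := by
      rintro (i | i)
      · exact Submodule.mem_sup_left (bL i).2
      · exact Submodule.mem_sup_right (bM i).2
    ext (i | i) (j | j)
    · simp only [Matrix.gram_apply, hU, Matrix.fromBlocks_apply₁₁, Matrix.one_apply]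
      exact (orthonormal_iff_ite.1 bU.orthonormal) i j
    · simp only [Matrix.gram_apply, hU, hR, Matrix.fromBlocks_apply₁₂, Matrix.zero_apply]
      exact Submodule.inner_left_of_mem_orthogonal (hmem j) (bU i).2
    · simp only [Matrix.gram_apply, hU, hR, Matrix.fromBlocks_apply₂₁, Matrix.zero_apply]
      exact Submodule.inner_right_of_mem_orthogonal (hmem i) (bU j).2
    · simp only [Matrix.gram_apply, hR, Matrix.fromBlocks_apply₂₂]
  rw [hgram, Matrix.det_fromBlocks_zero₂₁, Matrix.det_one, one_mul]

/-- Change of variables `v = w + l - m` along `ℝⁿ = (L + M)ᗮ ⊕ L ⊕ M`. The sign of `m` is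
chosen because `v` will be a difference of a point of a translate of `L` and one of `M`. -/
theorem lintegral_eq_subspaceDet_mul (h : Disjoint L M) {g : Euc n → ℝ≥0∞} (hg : Measurable g) :
    ∫⁻ v, g v = ENNReal.ofReal (subspaceDet L M) *
      ∫⁻ w : ((L ⊔ M)ᗮ : Submodule ℝ (Euc n)), ∫⁻ l : L, ∫⁻ m : M, g (w + l - m) := by
  have hT : Measurable (sumMap L M) :=
    (LinearMap.continuous_of_finiteDimensional (sumMap L M)).measurable
  have hneg : ∀ (w l : Euc n), ∫⁻ m : M, g (w + l - m) = ∫⁻ m : M, g (w + (l + m)) := by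
    intro w l
    rw [← lintegral_neg_eq_self]
    simp [sub_eq_add_neg, add_assoc]
  simp_rw [hneg]
  conv_lhs => rw [volume_eq_subspaceDet_smul_map h]
  rw [lintegral_smul_measure, lintegral_map hg hT, smul_eq_mul, Measure.volume_eq_prod,
    lintegral_prod (fun z => g (sumMap L M z)) (hg.comp hT).aemeasurable]
  congr 1
  refine lintegral_congr fun w => ?_
  rw [Measure.volume_eq_prod,
    lintegral_prod (fun z => g (sumMap L M (w, z)))
      ((hg.comp hT).comp measurable_prodMk_left).aemeasurable]
  rfl

theorem subspaceDet_eq_zero_of_not_disjoint (h : ¬ Disjoint L M) : subspaceDet L M = 0 := by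
  rw [subspaceDet, Real.sqrt_eq_zero (Matrix.posSemidef_gram ℝ _).det_nonneg]
  by_contra h0
  have hli := Matrix.det_gram_ne_zero_iff_linearIndependent.1 h0
  refine h ?_
  have h1 := (linearIndependent_sum.1 hli).2.2
  simp only [Sum.elim_comp_inl, Sum.elim_comp_inr] at h1
  have hs : ∀ K : Submodule ℝ (Euc n),
      Submodule.span ℝ (range fun i => (stdOrthonormalBasis ℝ K i : Euc n)) = K := by
    intro K
    have := (stdOrthonormalBasis ℝ K).toBasis.span_eq
    have h2 : (range fun i => (stdOrthonormalBasis ℝ K i : Euc n))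
        = K.subtype '' range (stdOrthonormalBasis ℝ K).toBasis := by
      rw [← range_comp]; simp [Function.comp_def]
    rw [h2, Submodule.span_image, this, Submodule.map_top, Submodule.range_subtype]
  rwa [hs, hs] at h1

/-- Tonelli's theorem for the orthogonal decomposition `ℝⁿ = L ⊕ Lᗮ`. -/
theorem lintegral_orthogonalDecomposition (L : Submodule ℝ (Euc n)) {g : Euc n → ℝ≥0∞}
    (hg : Measurable g) : ∫⁻ v, g v = ∫⁻ l : L, ∫⁻ x : Lᗮ, g (l + x) := by
  have h := L.orthogonalDecomposition.symm.measurePreserving.comp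
    (WithLp.volume_preserving_toLp L Lᗮ)
  rw [← h.lintegral_comp hg, Measure.volume_eq_prod,
    lintegral_prod (fun z => g ((L.orthogonalDecomposition.symm ∘ WithLp.toLp 2) z))
      (hg.comp h.measurable).aemeasurable]
  refine lintegral_congr fun l => lintegral_congr fun x => ?_
  simp

theorem volume_closedBall_eq_of_finrank {E : Type*} [NormedAddCommGroup E] [InnerProductSpace ℝ E]
    [FiniteDimensional ℝ E] [MeasurableSpace E] [BorelSpace E] {d : ℕ} (h : finrank ℝ E = d)
    (r : ℝ) :
    volume (Metric.closedBall (0 : E) r) = volume (Metric.closedBall (0 : Euc d) r) := by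
  subst h
  have := (stdOrthonormalBasis ℝ E).measurePreserving_repr
  rw [← this.measure_preimage measurableSet_closedBall.nullMeasurableSet]
  congr 1
  ext x; simp

end

/-! ### Polar coordinates in a linear subspace -/

section

open Module

variable {n : ℕ}

/-- The unit vector `w / ‖w‖`, with the arbitrary value `e` at `w = 0`. -/
def unitVec (e : EucSphere n) (w : Euc n) : EucSphere n :=
  if h : w = 0 then e else ⟨‖w‖⁻¹ • w, by simp [norm_smul, h]⟩

theorem coe_unitVec (e : EucSphere n) {w : Euc n} (h : w ≠ 0) :
    (unitVec e w : Euc n) = ‖w‖⁻¹ • w := by simp [unitVec, h]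

theorem measurable_unitVec (e : EucSphere n) : Measurable (unitVec e) := by
  have h : Measurable fun w : Euc n => if w = 0 then (e : Euc n) else ‖w‖⁻¹ • w :=
    Measurable.ite (measurableSet_singleton 0) measurable_const (by fun_prop)
  have h2 : ∀ w : Euc n, (unitVec e w : Euc n) = if w = 0 then (e : Euc n) else ‖w‖⁻¹ • w := by
    intro w; unfold unitVec; split_ifs <;> rfl
  have h3 : Measurable fun w => (unitVec e w : Euc n) := by simpa only [h2] using h
  exact h3.subtype_mk (h := fun w => (unitVec e w).2)

/-- Polar coordinates in `U`: the volume of the set of vectors of `U` with length in `B` and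
direction in `C`. -/
theorem volume_polar_rectangle (e : EucSphere n) (U : Submodule ℝ (Euc n))
    {B : Set ℝ} {C : Set (EucSphere n)} (hB : MeasurableSet B) (hB0 : B ⊆ Ioi 0)
    (hC : MeasurableSet C) :
    volume {w : U | ‖w‖ ∈ B ∧ unitVec e (w : Euc n) ∈ C} =
      (∫⁻ t in B, ENNReal.ofReal (t ^ (finrank ℝ U - 1))) * sphericalMeasure U C := by
  have hmp := (volume : Measure U).measurePreserving_homeomorphUnitSphereProd
  have hC' : MeasurableSet (sphereInclusion U ⁻¹' C) := by
    refine Measurable.subtype_mk (h := ?_) ?_ hC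
    exact (measurable_subtype_coe.comp measurable_subtype_coe)
  have hB' : MeasurableSet ((↑) ⁻¹' B : Set (Ioi (0 : ℝ))) := measurable_subtype_coe hB
  have hset : {w : U | ‖w‖ ∈ B ∧ unitVec e (w : Euc n) ∈ C} = Subtype.val ''
      (homeomorphUnitSphereProd U ⁻¹'
        ((sphereInclusion U ⁻¹' C) ×ˢ ((↑) ⁻¹' B : Set (Ioi (0 : ℝ))))) := by
    ext w
    have key : ∀ hw : w ≠ 0, sphereInclusion U (homeomorphUnitSphereProd U ⟨w, hw⟩).1
        = unitVec e (w : Euc n) := by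
      intro hw
      ext1
      rw [coe_unitVec _ (by simpa using hw)]
      simp [sphereInclusion]
    constructor
    · rintro ⟨h1, h2⟩
      have hw : w ≠ 0 := by simpa using hB0 h1
      refine ⟨⟨w, hw⟩, ⟨?_, ?_⟩, rfl⟩
      · rw [mem_preimage, key hw]; exact h2
      · simpa using h1
    · rintro ⟨⟨w', hw⟩, ⟨h1, h2⟩, rfl⟩
      refine ⟨by simpa using h2, ?_⟩
      rw [← key hw]; exact h1
  rw [hset, ← (MeasurableEmbedding.subtype_coe (measurableSet_singleton _).compl).comap_apply,
    hmp.measure_preimage (hC'.prod hB').nullMeasurableSet, Measure.prod_prod, mul_comm]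
  congr 1
  rw [Measure.volumeIoiPow, withDensity_apply _ hB',
    setLIntegral_subtype measurableSet_Ioi _ fun t : ℝ => ENNReal.ofReal (t ^ (finrank ℝ U - 1)),
    Subtype.image_preimage_coe, inter_eq_self_of_subset_right hB0]

end

/-! ### Regularized sums of projections -/

section

open Filter Topology

variable {n : ℕ} (L M : Submodule ℝ (Euc n))

/-- The sum `P_L + P_M` of the orthogonal projections onto `L` and `M`. -/
def sumProj : Euc n →L[ℝ] Euc n := L.starProjection + M.starProjection

theorem sumProj_apply (x : Euc n) :
    sumProj L M x = L.starProjection x + M.starProjection x := rfl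

theorem inner_sumProj_self (x : Euc n) :
    inner ℝ (sumProj L M x) x = ‖L.starProjection x‖ ^ 2 + ‖M.starProjection x‖ ^ 2 := by
  have h : ∀ K : Submodule ℝ (Euc n),
      inner ℝ (K.starProjection x) x = ‖K.starProjection x‖ ^ 2 := by
    intro K
    simpa using K.re_inner_starProjection_eq_normSq x
  rw [sumProj_apply, inner_add_left, h, h]

theorem sumProj_apply_mem (x : Euc n) : sumProj L M x ∈ L ⊔ M :=
  Submodule.add_mem_sup (L.starProjection_apply_mem x) (M.starProjection_apply_mem x)

theorem sumProj_apply_eq_zero {x : Euc n} (hx : x ∈ (L ⊔ M)ᗮ) : sumProj L M x = 0 := by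
  rw [← Submodule.inf_orthogonal] at hx
  rw [sumProj_apply, L.starProjection_apply_eq_zero_iff.2 hx.1,
    M.starProjection_apply_eq_zero_iff.2 hx.2, add_zero]

/-- The range of the self-adjoint operator `P_L + P_M` is `L + M`: every vector differs from some
`P_L t + P_M t` by a vector orthogonal to `L + M`. A vector `v` orthogonal to the range satisfies
`‖P_L v‖² + ‖P_M v‖² = ⟪(P_L + P_M) v, v⟫ = 0`. -/
theorem exists_sub_sumProj_mem_orthogonal (x : Euc n) :
    ∃ t, x - sumProj L M t ∈ (L ⊔ M)ᗮ := by
  set R := LinearMap.range (sumProj L M : Euc n →ₗ[ℝ] Euc n)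
  obtain ⟨t, ht⟩ := LinearMap.mem_range.1 (R.starProjection_apply_mem x)
  refine ⟨t, ?_⟩
  have h1 : x - sumProj L M t ∈ Rᗮ := by
    have := R.sub_starProjection_mem_orthogonal x
    rwa [← ht] at this
  generalize x - sumProj L M t = v at h1
  have h2 : inner ℝ (sumProj L M v) v = 0 :=
    Submodule.inner_right_of_mem_orthogonal (LinearMap.mem_range_self _ v) h1
  rw [inner_sumProj_self] at h2
  rw [← Submodule.inf_orthogonal]
  constructor
  · rw [SetLike.mem_coe, ← L.starProjection_apply_eq_zero_iff, ← norm_eq_zero, ← sq_eq_zero_iff]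
    nlinarith [sq_nonneg ‖L.starProjection v‖, sq_nonneg ‖M.starProjection v‖]
  · rw [SetLike.mem_coe, ← M.starProjection_apply_eq_zero_iff, ← norm_eq_zero, ← sq_eq_zero_iff]
    nlinarith [sq_nonneg ‖L.starProjection v‖, sq_nonneg ‖M.starProjection v‖]

/-- The regularization `P_L + P_M + ε` of `P_L + P_M`. It is invertible for every pair `L`, `M`
and every `ε > 0`. -/
def regProj (ε : ℝ) : Euc n →L[ℝ] Euc n := sumProj L M + ε • 1

theorem regProj_apply (ε : ℝ) (x : Euc n) : regProj L M ε x = sumProj L M x + ε • x := rfl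

theorem mul_norm_le_norm_regProj {ε : ℝ} (x : Euc n) :
    ε * ‖x‖ ≤ ‖regProj L M ε x‖ := by
  rcases eq_or_ne x 0 with rfl | hx
  · simp
  have h1 : inner ℝ (regProj L M ε x) x ≤ ‖regProj L M ε x‖ * ‖x‖ := real_inner_le_norm _ _
  rw [regProj_apply, inner_add_left, inner_sumProj_self, inner_smul_left,
    real_inner_self_eq_norm_sq, ← regProj_apply] at h1
  simp only [conj_trivial] at h1
  have hx0 : 0 < ‖x‖ := norm_pos_iff.2 hx
  refine le_of_mul_le_mul_right ?_ hx0
  nlinarith [sq_nonneg ‖L.starProjection x‖, sq_nonneg ‖M.starProjection x‖]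

/-- `P_L + P_M` is positive semidefinite, so `P_L + P_M + ε` is bounded below by `ε`. -/
theorem isUnit_regProj {ε : ℝ} (hε : 0 < ε) : IsUnit (regProj L M ε) := by
  rw [ContinuousLinearMap.isUnit_iff_bijective]
  have hinj : Function.Injective (regProj L M ε : Euc n →ₗ[ℝ] Euc n) := by
    rw [injective_iff_map_eq_zero]
    intro x hx
    have h := mul_norm_le_norm_regProj L M (ε := ε) x
    rw [show regProj L M ε x = 0 from hx, norm_zero] at h
    by_contra hx0
    have := mul_pos hε (norm_pos_iff.2 hx0)
    linarith
  exact ⟨hinj, LinearMap.injective_iff_surjective.1 hinj⟩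

/-- The inverse `(P_L + P_M + ε)⁻¹` for `ε > 0`. It is written with `Ring.inverse`, whose
continuity at units yields the continuity in `L` and `M`. -/
def regInv (ε : ℝ) : Euc n →L[ℝ] Euc n := Ring.inverse (regProj L M ε)

theorem regInv_regProj {ε : ℝ} (hε : 0 < ε) (x : Euc n) :
    regInv L M ε (regProj L M ε x) = x := by
  have := Ring.inverse_mul_cancel _ (isUnit_regProj L M hε)
  exact DFunLike.congr_fun this x

theorem regProj_regInv {ε : ℝ} (hε : 0 < ε) (x : Euc n) :
    regProj L M ε (regInv L M ε x) = x := by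
  have := Ring.mul_inverse_cancel _ (isUnit_regProj L M hε)
  exact DFunLike.congr_fun this x

theorem norm_smul_regInv_le {ε : ℝ} (hε : 0 < ε) (x : Euc n) :
    ‖ε • regInv L M ε x‖ ≤ ‖x‖ := by
  have := mul_norm_le_norm_regProj L M (ε := ε) (regInv L M ε x)
  rwa [regProj_regInv L M hε, ← Real.norm_of_nonneg hε.le, ← norm_smul,
    Real.norm_of_nonneg hε.le] at this

theorem regInv_sumProj {ε : ℝ} (hε : 0 < ε) (t : Euc n) :
    regInv L M ε (sumProj L M t) = t - ε • regInv L M ε t := by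
  have h := regInv_regProj L M hε t
  rw [regProj_apply, map_add, map_smul] at h
  exact eq_sub_of_add_eq h

theorem smul_regInv_of_mem_orthogonal {ε : ℝ} (hε : 0 < ε) {u : Euc n} (hu : u ∈ (L ⊔ M)ᗮ) :
    ε • regInv L M ε u = u := by
  have h := regInv_regProj L M hε u
  rwa [regProj_apply, sumProj_apply_eq_zero L M hu, zero_add, map_smul] at h

/-- The orthogonal projection onto `(L + M)ᗮ` is a pointwise limit of operators that depend
continuously on `L` and `M`, although it does not itself depend continuously on them. -/
theorem tendsto_smul_regInv (x : Euc n) :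
    Tendsto (fun ε => ε • regInv L M ε x) (𝓝[>] 0) (𝓝 ((L ⊔ M)ᗮ.starProjection x)) := by
  obtain ⟨t, ht⟩ := exists_sub_sumProj_mem_orthogonal L M x
  have hP : (L ⊔ M)ᗮ.starProjection x = x - sumProj L M t := by
    refine Submodule.eq_starProjection_of_mem_orthogonal ht ?_
    rw [sub_sub_cancel]
    exact (L ⊔ M).le_orthogonal_orthogonal (sumProj_apply_mem L M t)
  rw [hP, tendsto_iff_norm_sub_tendsto_zero]
  refine squeeze_zero' (g := fun ε : ℝ => ε * (‖t‖ + ‖t‖))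
    (Eventually.of_forall fun _ => norm_nonneg _) ?_ ?_
  · filter_upwards [self_mem_nhdsWithin] with ε hε
    have hε : 0 < ε := hε
    have h1 : ε • regInv L M ε x - (x - sumProj L M t) = ε • (t - ε • regInv L M ε t) := by
      rw [← regInv_sumProj L M hε, ← smul_regInv_of_mem_orthogonal L M hε ht, ← smul_sub, ← map_sub,
        sub_sub_cancel]
    rw [h1, norm_smul, Real.norm_of_nonneg hε.le]
    gcongr
    exact (norm_sub_le _ _).trans (by gcongr; exact norm_smul_regInv_le L M hε t)
  · have : Tendsto (fun ε : ℝ => ε * (‖t‖ + ‖t‖)) (𝓝 0) (𝓝 (0 * (‖t‖ + ‖t‖))) :=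
      (continuous_id.mul continuous_const).tendsto 0
    rw [zero_mul] at this
    exact this.mono_left nhdsWithin_le_nhds

/-- If `t` solves `(P_L + P_M) t = x` up to a vector orthogonal to `L + M`, then `P_K t`, for
`K` inside `L + M`, is the limit of `P_K (P_L + P_M + ε)⁻¹ x` as `ε ↓ 0`. -/
theorem tendsto_starProjection_regInv {K : Submodule ℝ (Euc n)} (hK : K ≤ L ⊔ M) {x t : Euc n}
    (ht : x - sumProj L M t ∈ (L ⊔ M)ᗮ) :
    Tendsto (fun ε => K.starProjection (regInv L M ε x)) (𝓝[>] 0) (𝓝 (K.starProjection t)) := by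
  have hz : ∀ u ∈ (L ⊔ M)ᗮ, K.starProjection u = 0 := fun u hu =>
    K.starProjection_apply_eq_zero_iff.2 (Submodule.orthogonal_le hK hu)
  have h1 : ∀ᶠ ε in 𝓝[>] (0 : ℝ), K.starProjection t - K.starProjection (ε • regInv L M ε t) =
      K.starProjection (regInv L M ε x) := by
    filter_upwards [self_mem_nhdsWithin] with ε hε
    have hε : 0 < ε := hε
    have h2 : regInv L M ε x = (t - ε • regInv L M ε t) + ε⁻¹ • (x - sumProj L M t) := by
      rw [← regInv_sumProj L M hε]
      conv_rhs => rw [← smul_regInv_of_mem_orthogonal L M hε ht]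
      rw [inv_smul_smul₀ hε.ne', ← map_add, add_sub_cancel]
    have h3 : K.starProjection (ε⁻¹ • (x - sumProj L M t)) = 0 :=
      hz _ (Submodule.smul_mem _ _ ht)
    rw [h2, K.starProjection.map_add, h3, add_zero, K.starProjection.map_sub]
  refine Tendsto.congr' h1 ?_
  have h3 := (K.starProjection.continuous.tendsto _).comp (tendsto_smul_regInv L M t)
  have h4 := (tendsto_const_nhds (x := K.starProjection t)).sub h3
  rwa [hz _ (Submodule.starProjection_apply_mem _ _), sub_zero] at h4

end

/-! ### Topology and measurability of flats -/

section

open Module (finrank)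
open Filter Topology

variable {n k k₁ k₂ : ℕ}

instance Gr.instSecondCountableTopology : SecondCountableTopology (Gr n k) :=
  TopologicalSpace.secondCountableTopology_induced _ _ _

instance Flat.instSecondCountableTopology : SecondCountableTopology (Flat n k) :=
  TopologicalSpace.secondCountableTopology_induced _ _ _

theorem Gr.continuous_starProjection :
    Continuous fun L : Gr n k => (L.1.starProjection : Euc n →L[ℝ] Euc n) :=
  continuous_induced_dom

theorem Flat.continuous_foot : Continuous (Flat.foot : Flat n k → Euc n) :=
  continuous_snd.comp (continuous_induced_dom (f := fun F : Flat n k =>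
    ((F.1.direction.starProjection : Euc n →L[ℝ] Euc n), F.foot)))

theorem Flat.continuous_starProjection :
    Continuous fun F : Flat n k => (F.1.direction.starProjection : Euc n →L[ℝ] Euc n) :=
  continuous_fst.comp (continuous_induced_dom (f := fun F : Flat n k =>
    ((F.1.direction.starProjection : Euc n →L[ℝ] Euc n), F.foot)))

theorem Flat.continuous_dir : Continuous (Flat.dir : Flat n k → Gr n k) :=
  continuous_induced_rng.2 Flat.continuous_starProjection

theorem Flat.measurable_foot : Measurable (Flat.foot : Flat n k → Euc n) :=
  Flat.continuous_foot.measurable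

theorem Flat.measurable_dir : Measurable (Flat.dir : Flat n k → Gr n k) :=
  Flat.continuous_dir.measurable

theorem Flat.foot_mem (F : Flat n k) : F.foot ∈ F.1 := by
  have : Nonempty F.1 := F.2.1.to_subtype
  exact EuclideanGeometry.orthogonalProjection_mem _

theorem Flat.foot_mem_orthogonal (F : Flat n k) : F.foot ∈ F.1.directionᗮ := by
  have : Nonempty F.1 := F.2.1.to_subtype
  have := EuclideanGeometry.orthogonalProjection_vsub_mem_direction_orthogonal F.1 0
  rwa [vsub_eq_sub, sub_zero] at this

theorem Flat.eq_foot {F : Flat n k} {x : Euc n} (hx : x ∈ F.1) (hx' : x ∈ F.1.directionᗮ) :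
    F.foot = x := by
  have h1 : F.foot - x ∈ F.1.direction := AffineSubspace.vsub_mem_direction F.foot_mem hx
  have h2 : F.foot - x ∈ F.1.directionᗮ := Submodule.sub_mem _ F.foot_mem_orthogonal hx'
  exact sub_eq_zero.1 (Submodule.disjoint_def.1 F.1.direction.orthogonal_disjoint _ h1 h2)

theorem Flat.mem_iff {F : Flat n k} {x y : Euc n} (hx : x ∈ F.1) :
    y ∈ F.1 ↔ y - x ∈ F.1.direction := by
  rw [← AffineSubspace.vsub_right_mem_direction_iff_mem hx]; rfl

/-- The flat `L + z`. -/
def flatOf (L : Gr n k) (z : Euc n) : Flat n k :=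
  ⟨AffineSubspace.mk' z L.1, ⟨z, AffineSubspace.self_mem_mk' _ _⟩, by
    rw [AffineSubspace.direction_mk']; exact L.2⟩

theorem mem_flatOf {L : Gr n k} {z x : Euc n} : x ∈ (flatOf L z).1 ↔ x - z ∈ L.1 :=
  AffineSubspace.mem_mk'

theorem direction_flatOf (L : Gr n k) (z : Euc n) : (flatOf L z).1.direction = L.1 :=
  AffineSubspace.direction_mk' _ _

theorem dir_flatOf (L : Gr n k) (z : Euc n) : (flatOf L z).dir = L :=
  Subtype.ext (direction_flatOf L z)

theorem flatOf_dir_foot (F : Flat n k) : flatOf F.dir F.foot = F :=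
  Subtype.ext (AffineSubspace.mk'_eq F.foot_mem)

theorem foot_flatOf (L : Gr n k) (z : Euc n) : (flatOf L z).foot = z - L.1.starProjection z := by
  refine Flat.eq_foot ?_ ?_
  · rw [mem_flatOf, sub_sub_cancel_left]
    exact Submodule.neg_mem _ (L.1.starProjection_apply_mem z)
  · rw [direction_flatOf]
    exact L.1.sub_starProjection_mem_orthogonal z

theorem translate_flatOf (L : Gr n k) (x z : Euc n) :
    (flatOf L z).translate x = flatOf L (x + z) := by
  refine Subtype.ext (AffineSubspace.ext_of_direction_eq ?_ ⟨x + z, ?_, ?_⟩)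
  · rw [direction_flatOf, Flat.translate, AffineSubspace.pointwise_vadd_direction, direction_flatOf]
  · exact AffineSubspace.vadd_mem_pointwise_vadd_iff.2 (AffineSubspace.self_mem_mk' z L.1)
  · exact AffineSubspace.self_mem_mk' _ _

theorem translate_eq_flatOf (F : Flat n k) (x : Euc n) :
    F.translate x = flatOf F.dir (x + F.foot) := by
  conv_lhs => rw [← flatOf_dir_foot F]
  exact translate_flatOf _ _ _

theorem continuous_flatOf : Continuous fun p : Gr n k × Euc n => flatOf p.1 p.2 := by
  refine continuous_induced_rng.2 ?_
  have h : Continuous fun p : Gr n k × Euc n => (p.1.1.starProjection : Euc n →L[ℝ] Euc n) :=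
    Gr.continuous_starProjection.comp continuous_fst
  have h2 : ((fun F : Flat n k => ((F.1.direction.starProjection : Euc n →L[ℝ] Euc n), F.foot)) ∘
      fun p : Gr n k × Euc n => flatOf p.1 p.2) =
      fun p => (p.1.1.starProjection, p.2 - p.1.1.starProjection p.2) := by
    funext p
    simp only [Function.comp_apply, foot_flatOf]
    congr 2
    exact direction_flatOf _ _
  rw [h2]
  exact h.prodMk (continuous_snd.sub (h.clm_apply continuous_snd))

theorem measurable_flatOf {α : Type*} [MeasurableSpace α] {L : α → Gr n k} {z : α → Euc n}
    (hL : Measurable L) (hz : Measurable z) : Measurable fun a => flatOf (L a) (z a) := by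
  have h := continuous_flatOf.measurable.comp (hL.prodMk hz)
  exact h

theorem measurable_starProjection_apply :
    Measurable fun p : Gr n k × Euc n => p.1.1.starProjection p.2 :=
  ((Gr.continuous_starProjection.comp continuous_fst).clm_apply continuous_snd).measurable

theorem measurable_translate (z : Euc n) : Measurable (Flat.translate z : Flat n k → Flat n k) := by
  have h : (Flat.translate z : Flat n k → Flat n k) = fun F => flatOf F.dir (z + F.foot) :=
    funext fun F => translate_eq_flatOf F z
  rw [h]
  exact measurable_flatOf Flat.measurable_dir (measurable_const.add Flat.measurable_foot)

/-- A flat meets a centred ball if and only if its point closest to the origin lies in the ball. -/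
theorem hitting_closedBall (r : ℝ) :
    Flat.hitting n k (Metric.closedBall 0 r) = {F | ‖F.foot‖ ≤ r} := by
  ext F
  constructor
  · rintro ⟨x, hx, hxr⟩
    have hxr' : ‖x‖ ≤ r := by simpa using hxr
    have h1 : x - F.foot ∈ F.1.direction := (Flat.mem_iff F.foot_mem).1 hx
    have h2 : inner ℝ F.foot (x - F.foot) = 0 :=
      Submodule.inner_left_of_mem_orthogonal h1 F.foot_mem_orthogonal
    have h3 := norm_add_sq_eq_norm_sq_add_norm_sq_of_inner_eq_zero _ _ h2
    rw [add_sub_cancel] at h3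
    exact (abs_le_of_sq_le_sq' (by nlinarith [sq_nonneg ‖x - F.foot‖]) (norm_nonneg x)).2.trans hxr'
  · intro h
    exact ⟨F.foot, F.foot_mem, by simpa using h⟩

theorem measurableSet_hitting_closedBall (r : ℝ) :
    MeasurableSet (Flat.hitting n k (Metric.closedBall 0 r)) := by
  rw [hitting_closedBall]
  exact measurableSet_le Flat.measurable_foot.norm measurable_const

theorem Gr.continuous_rotate (ρ : Euc n ≃ₗᵢ[ℝ] Euc n) :
    Continuous (Gr.rotate ρ : Gr n k → Gr n k) := by
  refine continuous_induced_rng.2 ?_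
  have h : ((fun L : Gr n k => (L.1.starProjection : Euc n →L[ℝ] Euc n)) ∘ Gr.rotate ρ) =
      fun L => (ρ.toContinuousLinearEquiv : Euc n →L[ℝ] Euc n) ∘L L.1.starProjection ∘L
        (ρ.symm.toContinuousLinearEquiv : Euc n →L[ℝ] Euc n) := by
    funext L
    ext1 x
    exact Submodule.starProjection_map_apply ρ L.1 x
  rw [h]
  exact continuous_const.clm_comp (Gr.continuous_starProjection.clm_comp continuous_const)

/-! ### General position -/

theorem continuous_regInv {ε : ℝ} (hε : 0 < ε) :
    Continuous fun p : Gr n k₁ × Gr n k₂ => regInv p.1.1 p.2.1 ε := by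
  have h : Continuous fun p : Gr n k₁ × Gr n k₂ => regProj p.1.1 p.2.1 ε :=
    ((Gr.continuous_starProjection.comp continuous_fst).add
      (Gr.continuous_starProjection.comp continuous_snd)).add continuous_const
  rw [continuous_iff_continuousAt]
  intro p
  obtain ⟨u, hu⟩ := isUnit_regProj p.1.1 p.2.1 hε
  refine ContinuousAt.comp (g := Ring.inverse) ?_ h.continuousAt
  rw [← hu]
  exact NormedRing.inverse_continuousAt u

theorem tendsto_one_div_add_nhdsGT : Tendsto (fun j : ℕ => (1 : ℝ) / (j + 1)) atTop (𝓝[>] 0) :=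
  tendsto_nhdsWithin_iff.2 ⟨tendsto_one_div_add_atTop_nhds_zero_nat,
    Eventually.of_forall fun j => by simp only [mem_Ioi]; positivity⟩

theorem measurable_orthogonal_sup_starProjection (x : Euc n) :
    Measurable fun p : Gr n k₁ × Gr n k₂ => (p.1.1 ⊔ p.2.1)ᗮ.starProjection x := by
  have hc (j : ℕ) : Measurable fun p : Gr n k₁ × Gr n k₂ =>
      ((1 : ℝ) / (j + 1)) • regInv p.1.1 p.2.1 ((1 : ℝ) / (j + 1)) x := by
    have h : Continuous fun p : Gr n k₁ × Gr n k₂ => regInv p.1.1 p.2.1 ((1 : ℝ) / (j + 1)) x :=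
      (continuous_regInv (by positivity)).clm_apply continuous_const
    exact h.measurable.const_smul ((1 : ℝ) / (j + 1))
  refine measurable_of_tendsto_metrizable hc (tendsto_pi_nhds.2 fun p => ?_)
  have h := (tendsto_smul_regInv p.1.1 p.2.1 x).comp tendsto_one_div_add_nhdsGT
  exact h

theorem inGeneralPosition_iff_disjoint {L : Gr n k₁} {M : Gr n k₂} :
    finrank ℝ (L.1 ⊔ M.1 : Submodule ℝ (Euc n)) = k₁ + k₂ ↔ Disjoint L.1 M.1 := by
  have h1 := Submodule.finrank_sup_add_finrank_inf_eq L.1 M.1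
  have h2 : finrank ℝ L.1 = k₁ := L.2
  have h3 : finrank ℝ M.1 = k₂ := M.2
  rw [disjoint_iff, ← Submodule.finrank_eq_zero]
  omega

/-- General position is a Borel condition on the directions: the dimension of `(L + M)ᗮ` is the
trace of the orthogonal projection onto it, a measurable function of `L` and `M`. -/
theorem measurableSet_disjoint : MeasurableSet {p : Gr n k₁ × Gr n k₂ | Disjoint p.1.1 p.2.1} := by
  let b := stdOrthonormalBasis ℝ (Euc n)
  have htr : ∀ U : Submodule ℝ (Euc n),
      ∑ i, inner ℝ (b i) (U.starProjection (b i)) = (finrank ℝ U : ℝ) := by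
    intro U
    rw [← LinearMap.IsProj.trace (p := U) (f := (U.starProjection : Euc n →ₗ[ℝ] Euc n))
      ⟨fun x => U.starProjection_apply_mem x,
        fun x hx => Submodule.starProjection_eq_self_iff.2 hx⟩]
    exact (LinearMap.trace_eq_sum_inner _ b).symm
  have hm : Measurable fun p : Gr n k₁ × Gr n k₂ => (finrank ℝ ((p.1.1 ⊔ p.2.1)ᗮ :
      Submodule ℝ (Euc n)) : ℝ) := by
    simp_rw [← htr]
    exact Finset.measurable_sum _ fun i _ =>
      measurable_const.inner (measurable_orthogonal_sup_starProjection (b i))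
  have hset : {p : Gr n k₁ × Gr n k₂ | Disjoint p.1.1 p.2.1} = {p | (finrank ℝ ((p.1.1 ⊔ p.2.1)ᗮ :
      Submodule ℝ (Euc n)) : ℝ) + (k₁ + k₂) = n} := by
    ext p
    rw [mem_ofPred_eq, mem_ofPred_eq, ← inGeneralPosition_iff_disjoint]
    have h := (p.1.1 ⊔ p.2.1).finrank_add_finrank_orthogonal
    rw [finrank_euclideanSpace_fin] at h
    norm_cast
    omega
  rw [hset]
  exact measurableSet_eq_fun (hm.add_const _) measurable_const

end

/-! ### The closest pair of two flats and the mass of its segment -/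

section

variable {n k₁ k₂ : ℕ}

theorem inGeneralPosition_iff {E : Flat n k₁} {F : Flat n k₂} :
    InGeneralPosition E F ↔ Disjoint E.1.direction F.1.direction :=
  inGeneralPosition_iff_disjoint (L := E.dir) (M := F.dir)

theorem flatDist_eq {E : Flat n k₁} {F : Flat n k₂} {x y : Euc n} (hx : x ∈ E.1) (hy : y ∈ F.1)
    (hxy : x - y ∈ (E.1.direction ⊔ F.1.direction)ᗮ) : flatDist E F = dist x y := by
  have : IsLeast (image2 dist (E.1 : Set (Euc n)) (F.1 : Set (Euc n))) (dist x y) := by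
    refine ⟨⟨x, hx, y, hy, rfl⟩, ?_⟩
    rintro _ ⟨x', hx', y', hy', rfl⟩
    have h1 : (x' - x) - (y' - y) ∈ E.1.direction ⊔ F.1.direction :=
      Submodule.sub_mem _ (Submodule.mem_sup_left ((Flat.mem_iff hx).1 hx'))
        (Submodule.mem_sup_right ((Flat.mem_iff hy).1 hy'))
    have h2 := norm_add_sq_eq_norm_sq_add_norm_sq_of_inner_eq_zero _ _
      (Submodule.inner_left_of_mem_orthogonal h1 hxy)
    have h3 : (x - y) + ((x' - x) - (y' - y)) = x' - y' := by abel
    rw [h3] at h2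
    rw [dist_eq_norm, dist_eq_norm]
    exact le_of_sq_le_sq (by nlinarith [sq_nonneg ‖(x' - x) - (y' - y)‖]) (norm_nonneg _)
  exact this.csInf_eq

/-- Points of two flats whose connecting vector is orthogonal to both flats are the closest pair. -/
theorem closestPair_eq {E : Flat n k₁} {F : Flat n k₂} (h : InGeneralPosition E F) {x y : Euc n}
    (hx : x ∈ E.1) (hy : y ∈ F.1) (hxy : x - y ∈ (E.1.direction ⊔ F.1.direction)ᗮ) :
    closestPair E F = (x, y) := by
  have h1 : IsClosestPair E F (x, y) := ⟨hx, hy, (flatDist_eq hx hy hxy).symm⟩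
  exact (existsUnique_isClosestPair E F h).unique (Classical.epsilon_spec ⟨_, h1⟩) h1

/-- A vector `t` for which `foot E - foot F - (P_L t + P_M t)` is orthogonal to both direction
spaces `L` and `M`. -/
def nearCoeff (E : Flat n k₁) (F : Flat n k₂) : Euc n :=
  (exists_sub_sumProj_mem_orthogonal E.1.direction F.1.direction (E.foot - F.foot)).choose

theorem nearCoeff_spec (E : Flat n k₁) (F : Flat n k₂) :
    E.foot - F.foot - sumProj E.1.direction F.1.direction (nearCoeff E F) ∈
      (E.1.direction ⊔ F.1.direction)ᗮ :=
  (exists_sub_sumProj_mem_orthogonal E.1.direction F.1.direction (E.foot - F.foot)).choose_spec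

/-- The points `foot E - P_L t` of `E` and `foot F + P_M t` of `F`, for `t = nearCoeff E F`. This
is the closest pair of flats in general position, in a form that is measurable in `(E, F)` on the
whole space of pairs. -/
def nearPair (E : Flat n k₁) (F : Flat n k₂) : Euc n × Euc n :=
  (E.foot - E.1.direction.starProjection (nearCoeff E F),
    F.foot + F.1.direction.starProjection (nearCoeff E F))

theorem closestPair_eq_nearPair {E : Flat n k₁} {F : Flat n k₂} (h : InGeneralPosition E F) :
    closestPair E F = nearPair E F := by
  refine closestPair_eq h ?_ ?_ ?_
  · rw [Flat.mem_iff E.foot_mem, sub_sub_cancel_left]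
    exact Submodule.neg_mem _ (Submodule.starProjection_apply_mem _ _)
  · rw [Flat.mem_iff F.foot_mem, add_sub_cancel_left]
    exact Submodule.starProjection_apply_mem _ _
  · have := nearCoeff_spec E F
    rw [sumProj_apply] at this
    convert this using 1
    abel

theorem measurable_nearPair :
    Measurable fun p : Flat n k₁ × Flat n k₂ => nearPair p.1 p.2 := by
  have hE : Continuous fun p : Flat n k₁ × Flat n k₂ => p.1.foot :=
    Flat.continuous_foot.comp continuous_fst
  have hF : Continuous fun p : Flat n k₁ × Flat n k₂ => p.2.foot :=
    Flat.continuous_foot.comp continuous_snd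
  have hPE : Continuous fun p : Flat n k₁ × Flat n k₂ =>
      (p.1.1.direction.starProjection : Euc n →L[ℝ] Euc n) :=
    Flat.continuous_starProjection.comp continuous_fst
  have hPF : Continuous fun p : Flat n k₁ × Flat n k₂ =>
      (p.2.1.direction.starProjection : Euc n →L[ℝ] Euc n) :=
    Flat.continuous_starProjection.comp continuous_snd
  have hdir : Continuous fun p : Flat n k₁ × Flat n k₂ => (p.1.dir, p.2.dir) :=
    (Flat.continuous_dir.comp continuous_fst).prodMk (Flat.continuous_dir.comp continuous_snd)
  have hr (j : ℕ) : Continuous fun p : Flat n k₁ × Flat n k₂ =>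
      regInv p.1.1.direction p.2.1.direction ((1 : ℝ) / (j + 1)) (p.1.foot - p.2.foot) := by
    have h : Continuous fun p : Gr n k₁ × Gr n k₂ => regInv p.1.1 p.2.1 ((1 : ℝ) / (j + 1)) :=
      continuous_regInv (by positivity)
    have h' := h.comp hdir
    exact Continuous.clm_apply h' (hE.sub hF)
  have h1 : Measurable fun p : Flat n k₁ × Flat n k₂ =>
      p.1.1.direction.starProjection (nearCoeff p.1 p.2) := by
    refine measurable_of_tendsto_metrizable (fun j => (hPE.clm_apply (hr j)).measurable)
      (tendsto_pi_nhds.2 fun p => ?_)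
    exact (tendsto_starProjection_regInv _ _ le_sup_left (nearCoeff_spec p.1 p.2)).comp
      tendsto_one_div_add_nhdsGT
  have h2 : Measurable fun p : Flat n k₁ × Flat n k₂ =>
      p.2.1.direction.starProjection (nearCoeff p.1 p.2) := by
    refine measurable_of_tendsto_metrizable (fun j => (hPF.clm_apply (hr j)).measurable)
      (tendsto_pi_nhds.2 fun p => ?_)
    exact (tendsto_starProjection_regInv _ _ le_sup_right (nearCoeff_spec p.1 p.2)).comp
      tendsto_one_div_add_nhdsGT
  exact (hE.measurable.sub h1).prodMk (hF.measurable.add h2)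

/-- The mass that a segment with midpoint `m` and connecting vector `w` gives to the set `s`: the
mean of the indicator of `s` over the two unit vectors `± w / ‖w‖`, if `0 < ‖w‖ ≤ δ`. -/
def segKernel (e : EucSphere n) (δ : ℝ) (s : Set (Euc n × ℝ × EucSphere n)) (m w : Euc n) : ℝ≥0∞ :=
  {w : Euc n | 0 < ‖w‖ ∧ ‖w‖ ≤ δ}.indicator (fun w => 2⁻¹ *
    (s.indicator 1 (m, ‖w‖, unitVec e w) + s.indicator 1 (m, ‖w‖, -unitVec e w))) w

theorem continuous_neg_sphere : Continuous fun u : EucSphere n => -u :=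
  Continuous.subtype_mk continuous_subtype_val.neg _

theorem measurable_segKernel (e : EucSphere n) (δ : ℝ) {s : Set (Euc n × ℝ × EucSphere n)}
    (hs : MeasurableSet s) {α : Type*} [MeasurableSpace α] {m w : α → Euc n} (hm : Measurable m)
    (hw : Measurable w) : Measurable fun a => segKernel e δ s (m a) (w a) := by
  have hu : Measurable fun a => unitVec e (w a) := (measurable_unitVec e).comp hw
  have hA : MeasurableSet {a | 0 < ‖w a‖ ∧ ‖w a‖ ≤ δ} :=
    (measurableSet_lt measurable_const hw.norm).inter (measurableSet_le hw.norm measurable_const)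
  have h1 : Measurable fun a => s.indicator (1 : Euc n × ℝ × EucSphere n → ℝ≥0∞)
      (m a, ‖w a‖, unitVec e (w a)) :=
    (measurable_one.indicator hs).comp (hm.prodMk (hw.norm.prodMk hu))
  have h2 : Measurable fun a => s.indicator (1 : Euc n × ℝ × EucSphere n → ℝ≥0∞)
      (m a, ‖w a‖, -unitVec e (w a)) :=
    (measurable_one.indicator hs).comp
      (hm.prodMk (hw.norm.prodMk (continuous_neg_sphere.measurable.comp hu)))
  exact ((h1.add h2).const_mul 2⁻¹).indicator hA

/-- The mass that the segment of the pair `p = (E, F)` gives to the set `s` in the proximity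
process, written with `nearPair` so that its measurability in `p` is visible. -/
def pairWeight (e : EucSphere n) (δ : ℝ) (s : Set (Euc n × ℝ × EucSphere n))
    (p : Flat n k₁ × Flat n k₂) : ℝ≥0∞ :=
  {p : Flat n k₁ × Flat n k₂ | Disjoint p.1.1.direction p.2.1.direction}.indicator
    (fun p => segKernel e δ s (midpoint ℝ (nearPair p.1 p.2).1 (nearPair p.1 p.2).2)
      ((nearPair p.1 p.2).1 - (nearPair p.1 p.2).2)) p

theorem measurable_pairWeight (e : EucSphere n) (δ : ℝ) {s : Set (Euc n × ℝ × EucSphere n)}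
    (hs : MeasurableSet s) :
    Measurable (pairWeight e δ s : Flat n k₁ × Flat n k₂ → ℝ≥0∞) := by
  have h1 : Measurable fun p : Flat n k₁ × Flat n k₂ => (p.1.dir, p.2.dir) :=
    (Flat.measurable_dir.comp measurable_fst).prodMk (Flat.measurable_dir.comp measurable_snd)
  have h2 := measurable_nearPair (n := n) (k₁ := k₁) (k₂ := k₂)
  have hmid : Measurable fun p : Flat n k₁ × Flat n k₂ =>
      midpoint ℝ (nearPair p.1 p.2).1 (nearPair p.1 p.2).2 := by
    simp only [midpoint_eq_smul_add]
    exact (h2.fst.add h2.snd).const_smul (⅟2 : ℝ)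
  exact (measurable_segKernel e δ hs hmid (h2.fst.fun_sub h2.snd)).indicator
    (h1 measurableSet_disjoint)

theorem measurable_pairWeight_comp (e : EucSphere n) (δ : ℝ) {s : Set (Euc n × ℝ × EucSphere n)}
    (hs : MeasurableSet s) {α : Type*} [MeasurableSpace α] {E : α → Flat n k₁} {F : α → Flat n k₂}
    (hE : Measurable E) (hF : Measurable F) : Measurable fun a => pairWeight e δ s (E a, F a) := by
  have h := (measurable_pairWeight e δ hs).comp (hE.prodMk hF)
  exact h

/-- The flats `L + m + w/2 + l` and `M + m - w/2 + l'` with `w` orthogonal to `L + M` have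
the closest pair `m ± w/2`. -/
theorem pairWeight_flatOf (e : EucSphere n) (δ : ℝ) (s : Set (Euc n × ℝ × EucSphere n))
    {L : Gr n k₁} {M : Gr n k₂} (h : Disjoint L.1 M.1) {m w l l' : Euc n}
    (hw : w ∈ (L.1 ⊔ M.1)ᗮ) (hl : l ∈ L.1) (hl' : l' ∈ M.1) :
    pairWeight e δ s (flatOf L (m + (2⁻¹ : ℝ) • w + l), flatOf M (m - (2⁻¹ : ℝ) • w + l')) =
      segKernel e δ s m w := by
  set E := flatOf L (m + (2⁻¹ : ℝ) • w + l)
  set F := flatOf M (m - (2⁻¹ : ℝ) • w + l')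
  have hd : Disjoint E.1.direction F.1.direction := by
    rwa [direction_flatOf, direction_flatOf]
  have hsub : (m + (2⁻¹ : ℝ) • w) - (m - (2⁻¹ : ℝ) • w) = w := by
    module
  have hc : closestPair E F = (m + (2⁻¹ : ℝ) • w, m - (2⁻¹ : ℝ) • w) := by
    refine closestPair_eq (inGeneralPosition_iff.2 hd) ?_ ?_ ?_
    · rw [mem_flatOf, sub_add_cancel_left]; exact Submodule.neg_mem _ hl
    · rw [mem_flatOf, sub_add_cancel_left]; exact Submodule.neg_mem _ hl'
    · rw [direction_flatOf, direction_flatOf, hsub]; exact hw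
  rw [pairWeight, indicator_of_mem (by exact hd),
    ← closestPair_eq_nearPair (inGeneralPosition_iff.2 hd), hc]
  simp only [hsub]
  congr 1
  rw [midpoint_eq_smul_add]
  simp only [invOf_eq_inv]
  module

theorem pairWeight_flatOf_of_not_disjoint (e : EucSphere n) (δ : ℝ)
    (s : Set (Euc n × ℝ × EucSphere n)) {L : Gr n k₁} {M : Gr n k₂} (h : ¬ Disjoint L.1 M.1)
    (z z' : Euc n) : pairWeight e δ s (flatOf L z, flatOf M z') = 0 := by
  refine indicator_of_notMem ?_ _
  rw [mem_ofPred_eq, direction_flatOf, direction_flatOf]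
  exact h

theorem mem_span_singleton_iff_eq_unitVec (e : EucSphere n) {w : Euc n} (hw : w ≠ 0) :
    {u : EucSphere n | (u : Euc n) ∈ Submodule.span ℝ {w}} = {unitVec e w, -unitVec e w} := by
  have hn : ‖w‖ ≠ 0 := norm_ne_zero_iff.2 hw
  ext u
  rw [mem_ofPred_eq, Submodule.mem_span_singleton, mem_insert_iff, mem_singleton_iff,
    Subtype.ext_iff, Subtype.ext_iff]
  have hneg : ((-unitVec e w : EucSphere n) : Euc n) = -(unitVec e w : Euc n) := rfl
  rw [hneg, coe_unitVec e hw]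
  constructor
  · rintro ⟨a, ha⟩
    have h1 : |a| * ‖w‖ = 1 := by
      rw [← Real.norm_eq_abs, ← norm_smul, ha]
      exact mem_sphere_zero_iff_norm.1 u.2
    have h2 : |a| = ‖w‖⁻¹ := eq_inv_of_mul_eq_one_left h1
    rw [← ha, ← h2, ← neg_smul]
    rcases abs_choice a with h | h
    · left; rw [h]
    · right; rw [h, neg_neg]
  · rintro (h | h)
    · exact ⟨‖w‖⁻¹, h.symm⟩
    · exact ⟨-‖w‖⁻¹, by rw [h, neg_smul]⟩

theorem segMeasure_apply (e : EucSphere n) {E : Flat n k₁} {F : Flat n k₂}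
    (h : (closestPair E F).1 - (closestPair E F).2 ≠ 0) {s : Set (Euc n × ℝ × EucSphere n)}
    (hs : MeasurableSet s) : segMeasure E F s = 2⁻¹ *
      (s.indicator 1 (segMidpoint E F, segLength E F,
          unitVec e ((closestPair E F).1 - (closestPair E F).2)) +
        s.indicator 1 (segMidpoint E F, segLength E F,
          -unitVec e ((closestPair E F).1 - (closestPair E F).2))) := by
  have hm : Measurable fun u : EucSphere n => (segMidpoint E F, segLength E F, u) :=
    measurable_const.prodMk (measurable_const.prodMk measurable_id)
  rw [segMeasure, Measure.map_apply hm hs, segDirection, mem_span_singleton_iff_eq_unitVec e h,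
    Measure.smul_apply, smul_eq_mul, Measure.restrict_apply (hm hs)]
  congr 1
  generalize unitVec e ((closestPair E F).1 - (closestPair E F).2) = v
  have hv := ne_neg_of_mem_unit_sphere ℝ v
  have hsplit : (fun u : EucSphere n => (segMidpoint E F, segLength E F, u)) ⁻¹' s ∩ {v, -v} =
      ((fun u : EucSphere n => (segMidpoint E F, segLength E F, u)) ⁻¹' s ∩ {v}) ∪
      ((fun u : EucSphere n => (segMidpoint E F, segLength E F, u)) ⁻¹' s ∩ {-v}) := by
    rw [← inter_union_distrib_left]; rfl
  rw [hsplit, measure_union _ ((hm hs).inter (measurableSet_singleton _))]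
  · congr 1
    · by_cases hmem : (segMidpoint E F, segLength E F, v) ∈ s
      · rw [inter_singleton_of_mem (by exact hmem), indicator_of_mem hmem, Measure.count_singleton]
        rfl
      · rw [inter_singleton_eq_empty.2 (by exact hmem), indicator_of_notMem hmem, measure_empty]
    · by_cases hmem : (segMidpoint E F, segLength E F, -v) ∈ s
      · rw [inter_singleton_of_mem (by exact hmem), indicator_of_mem hmem, Measure.count_singleton]
        rfl
      · rw [inter_singleton_eq_empty.2 (by exact hmem), indicator_of_notMem hmem, measure_empty]
  · exact (disjoint_singleton.2 hv).mono inter_subset_right inter_subset_right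

theorem disjoint_iff_closestPair_ne {E : Flat n k₁} {F : Flat n k₂} (h : InGeneralPosition E F) :
    Disjoint (E.1 : Set (Euc n)) (F.1 : Set (Euc n)) ↔
      (closestPair E F).1 - (closestPair E F).2 ≠ 0 := by
  have hc : IsClosestPair E F (closestPair E F) :=
    Classical.epsilon_spec (existsUnique_isClosestPair E F h).exists
  constructor
  · intro hd h0
    rw [sub_eq_zero] at h0
    exact Set.disjoint_left.1 hd hc.1 (h0 ▸ hc.2.1)
  · intro hne
    rw [Set.disjoint_left]
    intro z hz hz'
    refine hne ?_
    rw [closestPair_eq h hz hz' (by simp), sub_self]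

open Classical in
theorem indicator_segMeasure_eq_pairWeight (e : EucSphere n) (δ : ℝ)
    {s : Set (Euc n × ℝ × EucSphere n)} (hs : MeasurableSet s) (p : Flat n k₁ × Flat n k₂) :
    {p : Flat n k₁ × Flat n k₂ | Disjoint (p.1.1 : Set (Euc n)) (p.2.1 : Set (Euc n)) ∧
      InGeneralPosition p.1 p.2 ∧ flatDist p.1 p.2 ≤ δ}.indicator
        (fun p => segMeasure p.1 p.2 s) p = pairWeight e δ s p := by
  by_cases h : InGeneralPosition p.1 p.2
  swap
  · rw [indicator_of_notMem (fun h' => h h'.2.1), pairWeight,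
      indicator_of_notMem (fun h' => h (inGeneralPosition_iff.2 h'))]
  have hc : IsClosestPair p.1 p.2 (closestPair p.1 p.2) :=
    Classical.epsilon_spec (existsUnique_isClosestPair p.1 p.2 h).exists
  have hd : flatDist p.1 p.2 = ‖(closestPair p.1 p.2).1 - (closestPair p.1 p.2).2‖ := by
    rw [← hc.2.2, dist_eq_norm]
  have hmem : p ∈ {p : Flat n k₁ × Flat n k₂ | Disjoint p.1.1.direction p.2.1.direction} :=
    inGeneralPosition_iff.1 h
  rw [pairWeight, indicator_of_mem hmem, ← closestPair_eq_nearPair h, segKernel, indicator_apply,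
    indicator_apply]
  refine ite_congr (propext ?_) (fun h' => ?_) (fun _ => rfl)
  · rw [mem_ofPred_eq, mem_ofPred_eq, disjoint_iff_closestPair_ne h, hd, norm_pos_iff]
    exact and_congr_right fun _ => and_iff_right h
  · rw [segMeasure_apply e (norm_pos_iff.1 h'.1) hs, segLength, dist_eq_norm]
    rfl

end

/-! ### Flat processes as kernels and Campbell's formula -/

section

/-- A kernel of finite measures, with no uniform bound, is s-finite: cut it according to the integer
part of the total mass. -/
theorem isSFiniteKernel_of_apply_univ_lt_top {α β : Type*} [MeasurableSpace α] [MeasurableSpace β]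
    (η : Kernel α β) (h : ∀ a, η a univ < ∞) : IsSFiniteKernel η := by
  classical
  have hN : Measurable fun a => ⌊(η a univ).toNNReal⌋₊ :=
    Nat.measurable_floor.comp (η.measurable_coe MeasurableSet.univ).ennreal_toNNReal
  have hS : ∀ m : ℕ, MeasurableSet {a | ⌊(η a univ).toNNReal⌋₊ = m} := fun m =>
    hN (measurableSet_singleton m)
  have hfin : ∀ m : ℕ, IsFiniteKernel (Kernel.piecewise (hS m) η 0) := by
    intro m
    refine ⟨⟨m + 1, by finiteness, fun a => ?_⟩⟩
    rw [Kernel.piecewise_apply]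
    split_ifs with ha
    · have h1 := (Nat.lt_floor_add_one (η a univ).toNNReal).le
      rw [show ⌊(η a univ).toNNReal⌋₊ = m from ha] at h1
      rw [← ENNReal.coe_toNNReal (h a).ne]
      exact_mod_cast h1
    · simp
  have hsum : η = Kernel.sum fun m => Kernel.piecewise (hS m) η 0 := by
    ext a s hs
    rw [Kernel.sum_apply' _ _ hs, tsum_eq_single ⌊(η a univ).toNNReal⌋₊]
    · rw [Kernel.piecewise_apply', if_pos (by rfl)]
    · intro m hm
      rw [Kernel.piecewise_apply', if_neg (fun h => hm h.symm)]
      rfl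
  rw [hsum]
  infer_instance

theorem lintegral_countingMeasure {α : Type*} [MeasurableSpace α] (S : Set α) {f : α → ℝ≥0∞}
    (hf : Measurable f) : ∫⁻ x, f x ∂countingMeasure S = ∑' x : S, f x := by
  rw [countingMeasure, lintegral_sum_measure]
  simp_rw [lintegral_dirac' _ hf]

theorem countingMeasure_lt_top {α : Type*} [MeasurableSpace α] {S A : Set α}
    (hA : MeasurableSet A) (h : (S ∩ A).Finite) : countingMeasure S A < ∞ := by
  classical
  rw [← lintegral_indicator_one hA, lintegral_countingMeasure S (measurable_one.indicator hA),
    tsum_subtype S (A.indicator 1), tsum_eq_sum (s := h.toFinset)]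
  · refine ENNReal.sum_lt_top.2 fun x _ => ?_
    rw [indicator_indicator, indicator_apply]
    split_ifs <;> simp
  · intro x hx
    rw [indicator_indicator, indicator_of_notMem (by simpa using hx)]

end

section

variable {n k k₁ k₂ : ℕ} {Ω : Type*} [MeasurableSpace Ω] {P : Measure Ω}

theorem iUnion_hitting_closedBall :
    ⋃ j : ℕ, Flat.hitting n k (Metric.closedBall 0 (j : ℝ)) = univ := by
  refine eq_univ_of_forall fun F => mem_iUnion.2 ?_
  obtain ⟨j, hj⟩ := exists_nat_ge ‖F.foot‖
  exact ⟨j, by rw [hitting_closedBall]; exact hj⟩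

namespace FlatProcess

/-- The random counting measure of a flat process as a kernel from `Ω` to the space of flats. -/
def kernel (X : FlatProcess n k P) : Kernel Ω (Flat n k) :=
  ⟨X.randomMeasure, X.measurable_countingMeasure⟩

theorem kernel_apply (X : FlatProcess n k P) (ω : Ω) : X.kernel ω = X.randomMeasure ω := rfl

instance (X : FlatProcess n k P) : IsSFiniteKernel X.kernel := by
  let H : ℕ → Set (Flat n k) := fun j => Flat.hitting n k (Metric.closedBall 0 (j : ℝ))
  have hH : ∀ j, MeasurableSet (disjointed H j) :=
    MeasurableSet.disjointed fun j => measurableSet_hitting_closedBall _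
  have hfin : ∀ j, IsSFiniteKernel (X.kernel.restrict (hH j)) := by
    intro j
    refine isSFiniteKernel_of_apply_univ_lt_top _ fun ω => ?_
    rw [Kernel.restrict_apply, Measure.restrict_apply_univ]
    refine (measure_mono (disjointed_le H j)).trans_lt ?_
    exact countingMeasure_lt_top (measurableSet_hitting_closedBall _)
      (X.locallyFinite ω _ (isCompact_closedBall _ _))
  have hsum : X.kernel = Kernel.sum fun j => X.kernel.restrict (hH j) := by
    ext1 ω
    rw [Kernel.sum_apply]
    simp_rw [Kernel.restrict_apply]
    rw [← Measure.restrict_iUnion (disjoint_disjointed H) hH, iUnion_disjointed,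
      iUnion_hitting_closedBall, Measure.restrict_univ]
  rw [hsum]
  infer_instance

theorem intensityMeasure_apply (X : FlatProcess n k P) {A : Set (Flat n k)} (hA : MeasurableSet A) :
    X.intensityMeasure A = ∫⁻ ω, X.randomMeasure ω A ∂P :=
  Measure.bind_apply hA X.measurable_countingMeasure.aemeasurable

theorem intensityMeasure_hitting_closedBall_lt_top (X : FlatProcess n k P) (r : ℝ) :
    X.intensityMeasure (Flat.hitting n k (Metric.closedBall 0 r)) < ∞ := by
  rw [X.intensityMeasure_apply (measurableSet_hitting_closedBall r)]
  exact X.intensity_lt_top _ (isCompact_closedBall _ _)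

instance (X : FlatProcess n k P) : SigmaFinite X.intensityMeasure :=
  ⟨⟨{ set := fun j => Flat.hitting n k (Metric.closedBall 0 (j : ℝ))
      set_mem := fun _ => trivial
      finite := fun j => X.intensityMeasure_hitting_closedBall_lt_top j
      spanning := iUnion_hitting_closedBall }⟩⟩

end FlatProcess

variable (X₁ : FlatProcess n k₁ P) (X₂ : FlatProcess n k₂ P)

/-- The proximity process as an integral with respect to the product of the two processes. -/
theorem proximityProcess_apply (e : EucSphere n) (δ : ℝ) (ω : Ω)
    {s : Set (Euc n × ℝ × EucSphere n)} (hs : MeasurableSet s) :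
    proximityProcess X₁ X₂ δ ω s = ∫⁻ p, pairWeight e δ s p ∂(X₁.kernel ×ₖ X₂.kernel) ω := by
  have hW := measurable_pairWeight (k₁ := k₁) (k₂ := k₂) e δ hs
  have h₁ : ∀ f : Flat n k₁ → ℝ≥0∞, Measurable f →
      ∫⁻ x, f x ∂X₁.kernel ω = ∑' x : X₁.flats ω, f x := fun f hf => lintegral_countingMeasure _ hf
  have h₂ : ∀ x, ∫⁻ y, pairWeight e δ s (x, y) ∂X₂.kernel ω =
      ∑' y : X₂.flats ω, pairWeight e δ s (x, (y : Flat n k₂)) :=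
    fun x => lintegral_countingMeasure _ (hW.comp measurable_prodMk_left)
  rw [Kernel.prod_apply, lintegral_prod _ hW.aemeasurable, h₁ _ hW.lintegral_prod_right']
  simp_rw [h₂]
  rw [proximityProcess, Measure.sum_apply _ hs,
    tsum_subtype (proximityPairs X₁ X₂ δ ω) (fun p => segMeasure p.1 p.2 s), ENNReal.tsum_prod',
    tsum_subtype (X₁.flats ω) (fun x => ∑' y : X₂.flats ω, pairWeight e δ s (x, (y : Flat n k₂)))]
  refine tsum_congr fun x => ?_
  by_cases hx : x ∈ X₁.flats ω
  · rw [indicator_of_mem hx, tsum_subtype (X₂.flats ω) (fun y => pairWeight e δ s (x, y))]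
    refine tsum_congr fun y => ?_
    by_cases hy : y ∈ X₂.flats ω
    · rw [indicator_of_mem hy, ← indicator_segMeasure_eq_pairWeight e δ hs]
      classical
      rw [indicator_apply, indicator_apply]
      refine if_congr ?_ rfl rfl
      exact ⟨fun h => h.2.2, fun h => ⟨hx, hy, h⟩⟩
    · rw [indicator_of_notMem hy, indicator_of_notMem fun h => hy h.2.1]
  · rw [indicator_of_notMem hx, ENNReal.tsum_eq_zero]
    exact fun y => indicator_of_notMem (fun h => hx h.1) _

theorem measurable_proximityProcess (e : EucSphere n) (δ : ℝ) :
    Measurable (proximityProcess X₁ X₂ δ) := by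
  refine Measure.measurable_of_measurable_coe _ fun s hs => ?_
  simp_rw [proximityProcess_apply X₁ X₂ e δ _ hs]
  exact (measurable_pairWeight e δ hs).lintegral_kernel

variable {X₁ X₂}

/-- Campbell's formula for two independent processes: the expectation of the product `X₁ ⊗ X₂` is
the product of the intensity measures. -/
theorem bind_kernel_prod_eq (hind : IndepFun X₁.randomMeasure X₂.randomMeasure P) :
    P.bind (X₁.kernel ×ₖ X₂.kernel) = X₁.intensityMeasure.prod X₂.intensityMeasure := by
  refine (Measure.prod_eq fun s t hs ht => ?_).symm
  rw [Measure.bind_apply (hs.prod ht) (Kernel.aemeasurable _), X₁.intensityMeasure_apply hs,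
    X₂.intensityMeasure_apply ht]
  simp_rw [Kernel.prod_apply, Measure.prod_prod, FlatProcess.kernel_apply]
  have h1 : Measurable fun ω => X₁.randomMeasure ω s := X₁.kernel.measurable_coe hs
  have h2 : Measurable fun ω => X₂.randomMeasure ω t := X₂.kernel.measurable_coe ht
  exact lintegral_mul_eq_lintegral_mul_lintegral_of_indepFun'' h1.aemeasurable h2.aemeasurable
    (hind.comp (Measure.measurable_coe hs) (Measure.measurable_coe ht))

theorem proximityIntensity_apply (e : EucSphere n) (δ : ℝ)
    (hind : IndepFun X₁.randomMeasure X₂.randomMeasure P)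
    {s : Set (Euc n × ℝ × EucSphere n)} (hs : MeasurableSet s) :
    proximityIntensity X₁ X₂ δ s =
      ∫⁻ E, ∫⁻ F, pairWeight e δ s (E, F) ∂X₂.intensityMeasure ∂X₁.intensityMeasure := by
  have hW := measurable_pairWeight (k₁ := k₁) (k₂ := k₂) e δ hs
  rw [proximityIntensity,
    Measure.bind_apply hs (measurable_proximityProcess X₁ X₂ e δ).aemeasurable]
  simp_rw [proximityProcess_apply X₁ X₂ e δ _ hs]
  rw [← Measure.lintegral_bind (Kernel.aemeasurable _) hW.aemeasurable, bind_kernel_prod_eq hind,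
    lintegral_prod _ hW.aemeasurable]

end

/-! ### Disintegration of translation invariant intensity measures -/

section

open Module (finrank)

variable {n k : ℕ}

/-- The indicator function of the closed unit ball. -/
def ballInd : Euc n → ℝ≥0∞ := (Metric.closedBall 0 1).indicator 1

theorem measurable_ballInd : Measurable (ballInd : Euc n → ℝ≥0∞) :=
  measurable_one.indicator measurableSet_closedBall

/-- The volume `κ_d` of the `d`-dimensional unit ball. -/
def ballVol (d : ℕ) : ℝ≥0∞ := volume (Metric.closedBall (0 : Euc d) 1)

theorem ballVol_ne_zero (d : ℕ) : ballVol d ≠ 0 :=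
  (Metric.measure_closedBall_pos _ _ one_pos).ne'

theorem ballVol_ne_top (d : ℕ) : ballVol d ≠ ∞ := measure_closedBall_lt_top.ne

theorem lintegral_ballInd_add {d : ℕ} {V : Submodule ℝ (Euc n)} (hV : finrank ℝ V = d) {a : Euc n}
    (ha : a ∈ V) : ∫⁻ x : V, ballInd (a + (x : Euc n)) = ballVol d := by
  have h := lintegral_add_left_eq_self (μ := (volume : Measure V))
    (fun x : V => ballInd (x : Euc n)) ⟨a, ha⟩
  have h2 : (fun x : V => ballInd (x : Euc n)) = (Metric.closedBall (0 : V) 1).indicator 1 := by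
    classical
    funext x
    rw [ballInd, indicator_apply, indicator_apply]
    refine if_congr ?_ rfl rfl
    simp
  simp only [Submodule.coe_add] at h
  rw [h, h2, lintegral_indicator_one measurableSet_closedBall,
    volume_closedBall_eq_of_finrank hV, ballVol]

theorem indicator_hitting_eq_ballInd_foot (F : Flat n k) :
    (Flat.hitting n k (Metric.closedBall 0 1)).indicator (1 : Flat n k → ℝ≥0∞) F =
      ballInd F.foot := by
  classical
  rw [ballInd, indicator_apply, indicator_apply, hitting_closedBall]
  refine if_congr ?_ rfl rfl
  simp

theorem measurable_translate_uncurry :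
    Measurable fun p : Flat n k × Euc n => p.1.translate p.2 := by
  simp_rw [translate_eq_flatOf]
  exact measurable_flatOf (Flat.measurable_dir.comp measurable_fst)
    (measurable_snd.add (Flat.measurable_foot.comp measurable_fst))

/-- The indicator function of the cylinder of the points whose projection to `L` has norm at most
`1`. Its integral over each translate of `L` is `κ_k`. -/
def cylInd (L : Gr n k) (z : Euc n) : ℝ≥0∞ := ballInd (L.1.starProjection z)

theorem measurable_cylInd {α : Type*} [MeasurableSpace α] {L : α → Gr n k} {z : α → Euc n}
    (hL : Measurable L) (hz : Measurable z) : Measurable fun a => cylInd (L a) (z a) := by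
  have h := (measurable_ballInd.comp measurable_starProjection_apply).comp (hL.prodMk hz)
  exact h

theorem dir_translate (F : Flat n k) (z : Euc n) : (F.translate z).dir = F.dir := by
  rw [translate_eq_flatOf, dir_flatOf]

theorem starProjection_foot (F : Flat n k) : F.dir.1.starProjection F.foot = 0 :=
  (Submodule.starProjection_apply_eq_zero_iff _).2 F.foot_mem_orthogonal

theorem cylInd_foot_sub (F : Flat n k) (z : Euc n) :
    cylInd F.dir (F.foot - z) = cylInd F.dir z := by
  classical
  rw [cylInd, cylInd, map_sub, starProjection_foot, zero_sub, ballInd, indicator_apply,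
    indicator_apply]
  refine if_congr ?_ rfl rfl
  simp

theorem lintegral_ballInd_mul_ballInd_starProjection {d d' : ℕ} {V : Submodule ℝ (Euc n)}
    (hV : finrank ℝ V = d) (hV' : finrank ℝ Vᗮ = d') {a : Euc n} (ha : a ∈ Vᗮ) :
    ∫⁻ z, ballInd (a + (z - V.starProjection z)) * ballInd (V.starProjection z) =
      ballVol d' * ballVol d := by
  have hP : Measurable fun z => V.starProjection z := V.starProjection.continuous.measurable
  have hm : Measurable fun z => ballInd (a + (z - V.starProjection z)) *
      ballInd (V.starProjection z) :=
    (measurable_ballInd.comp (measurable_const.add (measurable_id.sub hP))).fun_mul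
      (measurable_ballInd.comp hP)
  rw [lintegral_orthogonalDecomposition V hm]
  have h1 : ∀ (l : V) (x : Vᗮ), V.starProjection ((l : Euc n) + x) = l := by
    intro l x
    rw [map_add, Submodule.starProjection_eq_self_iff.2 l.2,
      (Submodule.starProjection_apply_eq_zero_iff _).2 x.2, add_zero]
  simp_rw [h1, add_sub_cancel_left]
  have h2 : Measurable fun x : Vᗮ => ballInd (a + (x : Euc n)) :=
    measurable_ballInd.comp (measurable_const.add measurable_subtype_coe)
  have h3 : Measurable fun l : V => ballInd (l : Euc n) :=
    measurable_ballInd.comp measurable_subtype_coe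
  have h4 := lintegral_ballInd_add hV V.zero_mem
  simp only [zero_add] at h4
  simp_rw [lintegral_mul_const _ h2, lintegral_ballInd_add hV' ha]
  rw [lintegral_const_mul _ h3, h4]

/-- The translates of a flat that meet the unit ball: since `‖foot (F + z)‖ ≤ 1` only constrains
the component of `z` orthogonal to `F`, the cylinder indicator bounds the other component. -/
theorem lintegral_ballInd_foot_translate (F : Flat n k) :
    ∫⁻ z, ballInd (F.translate z).foot * cylInd F.dir z = ballVol (n - k) * ballVol k := by
  have hL' : finrank ℝ F.dir.1ᗮ = n - k := by
    have h := F.dir.1.finrank_add_finrank_orthogonal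
    rw [finrank_euclideanSpace_fin, F.dir.2] at h
    omega
  rw [← lintegral_ballInd_mul_ballInd_starProjection F.dir.2 hL' F.foot_mem_orthogonal]
  refine lintegral_congr fun z => ?_
  rw [translate_eq_flatOf, foot_flatOf, map_add, starProjection_foot, add_zero, cylInd,
    add_comm z, add_sub_assoc]

/-- Disintegration of a translation invariant measure `Θ` on the space of flats. Integrate
`f F · 𝟙{‖foot (F + z)‖ ≤ 1} · 𝟙{‖P_L z‖ ≤ 1}` over `F` and `z`: integrating over `z` first gives
the left-hand side, and the substitution of `F - z` for `F`, under which `Θ` is invariant, turns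
it into the right-hand side. -/
theorem lintegral_flat_eq {Θ : Measure (Flat n k)} [SigmaFinite Θ]
    (hΘ : ∀ z : Euc n, Θ.map (Flat.translate z) = Θ) {f : Flat n k → ℝ≥0∞} (hf : Measurable f) :
    ballVol (n - k) * ballVol k * ∫⁻ F, f F ∂Θ = ∫⁻ F, ballInd F.foot *
      (∫⁻ z, f (flatOf F.dir z) * cylInd F.dir z) ∂Θ := by
  have hj : Measurable fun p : Flat n k × Euc n => cylInd p.1.dir p.2 :=
    measurable_cylInd (Flat.measurable_dir.comp measurable_fst) measurable_snd
  have hw : Measurable fun F : Flat n k => ballInd F.foot :=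
    measurable_ballInd.comp Flat.measurable_foot
  have hwt : Measurable fun p : Flat n k × Euc n => ballInd (p.1.translate p.2).foot :=
    hw.comp measurable_translate_uncurry
  have hft : Measurable fun p : Flat n k × Euc n => f (p.1.translate (-p.2)) :=
    hf.comp (measurable_translate_uncurry.comp (measurable_fst.prodMk measurable_snd.neg))
  have hwj : Measurable (Function.uncurry fun (F : Flat n k) (z : Euc n) =>
      ballInd (F.translate z).foot * cylInd F.dir z) := hwt.fun_mul hj
  have hm₁ : Measurable (Function.uncurry fun (F : Flat n k) (z : Euc n) =>
      f F * (ballInd (F.translate z).foot * cylInd F.dir z)) :=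
    (hf.comp measurable_fst).fun_mul hwj
  have hm₂ : Measurable (Function.uncurry fun (F : Flat n k) (z : Euc n) =>
      f (F.translate (-z)) * (ballInd F.foot * cylInd F.dir z)) :=
    hft.fun_mul ((hw.comp measurable_fst).fun_mul hj)
  have h₁ : ∀ F : Flat n k, ∫⁻ z, f F * (ballInd (F.translate z).foot * cylInd F.dir z) =
      f F * (ballVol (n - k) * ballVol k) := by
    intro F
    have h : Measurable fun z : Euc n => ballInd (F.translate z).foot * cylInd F.dir z :=
      hwj.of_uncurry_left
    rw [lintegral_const_mul _ h, lintegral_ballInd_foot_translate]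
  -- invariance of `Θ` under the translation by `-z`
  have h₂ : ∀ z : Euc n, ∫⁻ F, f F * (ballInd (F.translate z).foot * cylInd F.dir z) ∂Θ =
      ∫⁻ F, f (F.translate (-z)) * (ballInd F.foot * cylInd F.dir z) ∂Θ := by
    intro z
    have h : Measurable fun F : Flat n k =>
        f F * (ballInd (F.translate z).foot * cylInd F.dir z) :=
      hm₁.of_uncurry_right
    conv_lhs => rw [← hΘ (-z)]
    rw [lintegral_map h (measurable_translate _)]
    refine lintegral_congr fun F => ?_
    have h' : (F.translate (-z)).translate z = F := by
      rw [translate_eq_flatOf F, translate_flatOf, add_neg_cancel_left, flatOf_dir_foot]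
    rw [h', dir_translate]
  -- the reflection `z ↦ foot F - z` turns `F - z` into `L + z`
  have h₃ : ∀ F : Flat n k, ∫⁻ z, f (F.translate (-z)) * (ballInd F.foot * cylInd F.dir z) =
      ballInd F.foot * ∫⁻ z, f (flatOf F.dir z) * cylInd F.dir z := by
    intro F
    have hg : Measurable fun z => f (flatOf F.dir z) * cylInd F.dir z :=
      (hf.comp (measurable_flatOf measurable_const measurable_id)).fun_mul
        (measurable_cylInd measurable_const measurable_id)
    rw [← lintegral_const_mul _ hg, ← lintegral_sub_left_eq_self _ F.foot]
    refine lintegral_congr fun z => ?_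
    rw [translate_eq_flatOf, neg_add_eq_sub, sub_sub_cancel, cylInd_foot_sub, mul_left_comm]
  have hswap₁ := lintegral_lintegral_swap (μ := Θ) (ν := volume)
    (f := fun F z => f F * (ballInd (F.translate z).foot * cylInd F.dir z)) hm₁.aemeasurable
  have hswap₂ := lintegral_lintegral_swap (μ := Θ) (ν := volume)
    (f := fun F z => f (F.translate (-z)) * (ballInd F.foot * cylInd F.dir z)) hm₂.aemeasurable
  simp_rw [h₂, h₁] at hswap₁
  simp_rw [h₃] at hswap₂
  rw [hswap₂, ← hswap₁, lintegral_mul_const _ hf, mul_comm]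

namespace FlatProcess

variable {Ω : Type*} [MeasurableSpace Ω] {P : Measure Ω}

theorem lintegral_foot_dir (X : FlatProcess n k P) {g : Gr n k → ℝ≥0∞} (hg : Measurable g) :
    ∫⁻ F, ballInd F.foot * g F.dir ∂X.intensityMeasure =
      X.intensityMeasure (Flat.hitting n k (Metric.closedBall 0 1)) *
        ∫⁻ L, g L ∂X.directionalDistribution := by
  set H := Flat.hitting n k (Metric.closedBall 0 1) with hH_def
  have hH : MeasurableSet H := measurableSet_hitting_closedBall 1
  have h1 : ∫⁻ F, ballInd F.foot * g F.dir ∂X.intensityMeasure =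
      ∫⁻ F in H, g F.dir ∂X.intensityMeasure := by
    rw [← lintegral_indicator hH]
    refine lintegral_congr fun F => ?_
    rw [← indicator_hitting_eq_ballInd_foot, ← hH_def]
    classical
    rw [indicator_apply, indicator_apply]
    split_ifs <;> simp
  rw [h1, directionalDistribution, lintegral_map hg Flat.measurable_dir, ProbabilityTheory.cond,
    lintegral_smul_measure, smul_eq_mul, ← mul_assoc]
  rcases eq_or_ne (X.intensityMeasure H) 0 with h0 | h0
  · rw [h0, zero_mul, zero_mul, setLIntegral_measure_zero _ _ h0]
  · rw [ENNReal.mul_inv_cancel h0 (X.intensityMeasure_hitting_closedBall_lt_top 1).ne, one_mul]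

/-- The intensity measure of a weakly stationary process is `γ` times the distribution of `L + z`
for `L` with the directional distribution and `z` uniform on `Lᗮ`. The uniform point of `Lᗮ` is
encoded by Lebesgue measure on the cylinder `cylInd L`, which accounts for the factor `κ_k`. -/
theorem lintegral_intensityMeasure (X : FlatProcess n k P) (hX : X.IsWeaklyStationary)
    {f : Flat n k → ℝ≥0∞} (hf : Measurable f) :
    ballVol k * ∫⁻ F, f F ∂X.intensityMeasure = X.intensity *
      ∫⁻ L, (∫⁻ z, f (flatOf L z) * cylInd L z) ∂X.directionalDistribution := by
  have h := lintegral_flat_eq hX hf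
  have hg : Measurable fun L : Gr n k => ∫⁻ z, f (flatOf L z) * cylInd L z :=
    ((hf.comp (measurable_flatOf measurable_fst measurable_snd)).fun_mul
      (measurable_cylInd measurable_fst measurable_snd)).lintegral_prod_right'
  rw [X.lintegral_foot_dir hg] at h
  rw [intensity, ENNReal.div_eq_inv_mul, mul_assoc, ← h, ← mul_assoc, ← mul_assoc, ← ballVol,
    ENNReal.inv_mul_cancel (ballVol_ne_zero _) (ballVol_ne_top _), one_mul]

end FlatProcess

end

/-! ### The intensity measure as an integral over directions -/

section

open Module (finrank)

variable {n k₁ k₂ : ℕ}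

theorem lintegral_ballInd_starProjection_add {d : ℕ} {V : Submodule ℝ (Euc n)}
    (hV : finrank ℝ V = d) (m : Euc n) :
    ∫⁻ x : V, ballInd (V.starProjection (m + (x : Euc n))) = ballVol d := by
  rw [← lintegral_ballInd_add hV (V.starProjection_apply_mem m)]
  refine lintegral_congr fun x => ?_
  rw [map_add, Submodule.starProjection_eq_self_iff.2 x.2]

/-- The contribution of the directions `L` and `M` to the intensity measure of the set `s`:
`[L, M]` times the integral of the mass `segKernel` over all midpoints `m` in `ℝⁿ` and all
connecting vectors `w` orthogonal to `L + M`. -/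
def segIntegral (e : EucSphere n) (δ : ℝ) (s : Set (Euc n × ℝ × EucSphere n))
    (L : Gr n k₁) (M : Gr n k₂) : ℝ≥0∞ :=
  ENNReal.ofReal (subspaceDet L.1 M.1) *
    ∫⁻ w : ((L.1 ⊔ M.1)ᗮ : Submodule ℝ (Euc n)), ∫⁻ m, segKernel e δ s m w

theorem measurable_pairWeight_mul (e : EucSphere n) (δ : ℝ) {s : Set (Euc n × ℝ × EucSphere n)}
    (hs : MeasurableSet s) {α : Type*} [MeasurableSpace α] {L : α → Gr n k₁} {M : α → Gr n k₂}
    {z z' : α → Euc n} (hL : Measurable L) (hM : Measurable M) (hz : Measurable z)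
    (hz' : Measurable z') :
    Measurable fun a => pairWeight e δ s (flatOf (L a) (z a), flatOf (M a) (z' a)) *
      (cylInd (M a) (z' a) * cylInd (L a) (z a)) :=
  (measurable_pairWeight_comp e δ hs (measurable_flatOf hL hz) (measurable_flatOf hM hz')).fun_mul
    ((measurable_cylInd hM hz').fun_mul (measurable_cylInd hL hz))

/-- The directions along `V` and `W` integrate out to the volumes of their unit balls. -/
theorem lintegral_mul_ballInd_mul_ballInd {d d' : ℕ} {V W : Submodule ℝ (Euc n)}
    (hV : finrank ℝ V = d) (hW : finrank ℝ W = d') {φ : Euc n → ℝ≥0∞} (hφ : Measurable φ) :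
    ∫⁻ l : V, ∫⁻ l' : W, ∫⁻ m, φ m * (ballInd (W.starProjection (m + (l' : Euc n))) *
      ballInd (V.starProjection (m + (l : Euc n)))) = ballVol d * ballVol d' * ∫⁻ m, φ m := by
  have hP : ∀ K : Submodule ℝ (Euc n), Measurable fun p : K × Euc n =>
      ballInd (K.starProjection (p.2 + (p.1 : Euc n))) := fun K =>
    measurable_ballInd.comp (K.starProjection.continuous.measurable.comp
      (measurable_snd.add (measurable_subtype_coe.comp measurable_fst)))
  have h1 : ∀ l : V, ∫⁻ l' : W, ∫⁻ m, φ m * (ballInd (W.starProjection (m + (l' : Euc n))) *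
        ballInd (V.starProjection (m + (l : Euc n)))) =
      ∫⁻ m, φ m * (ballVol d' * ballInd (V.starProjection (m + (l : Euc n)))) := by
    intro l
    have hl : Measurable fun m : Euc n => ballInd (V.starProjection (m + (l : Euc n))) := by
      have h := (hP V).comp (measurable_prodMk_left (x := l))
      exact h
    have hm : Measurable (Function.uncurry fun (l' : W) (m : Euc n) => φ m *
        (ballInd (W.starProjection (m + (l' : Euc n))) *
          ballInd (V.starProjection (m + (l : Euc n))))) :=
      (hφ.comp measurable_snd).fun_mul ((hP W).fun_mul (hl.comp measurable_snd))
    rw [lintegral_lintegral_swap hm.aemeasurable]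
    refine lintegral_congr fun m => ?_
    have hb : Measurable fun l' : W => ballInd (W.starProjection (m + (l' : Euc n))) := by
      have h := (hP W).comp (measurable_prodMk_right (y := m))
      exact h
    rw [lintegral_const_mul _ (hb.mul_const _), lintegral_mul_const _ hb,
      lintegral_ballInd_starProjection_add hW]
  simp_rw [h1]
  have hm : Measurable (Function.uncurry fun (l : V) (m : Euc n) => φ m *
      (ballVol d' * ballInd (V.starProjection (m + (l : Euc n))))) :=
    (hφ.comp measurable_snd).fun_mul ((hP V).const_mul _)
  rw [lintegral_lintegral_swap hm.aemeasurable, ← lintegral_const_mul _ hφ]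
  refine lintegral_congr fun m => ?_
  have hb : Measurable fun l : V => ballInd (V.starProjection (m + (l : Euc n))) := by
    have h := (hP V).comp (measurable_prodMk_right (y := m))
    exact h
  rw [lintegral_const_mul _ (hb.const_mul _), lintegral_const_mul _ hb,
    lintegral_ballInd_starProjection_add hV]
  ring

/-- The change of variables `z = m + w/2 + l`, `z' = m - w/2 + l'` with `w` orthogonal to `L + M`,
`l` in `L` and `l'` in `M`. For fixed `z'` it is the decomposition `z - z' = w + l - l'`, with
Jacobian `[L, M]`; the midpoint `m` is a translate of `z'`. -/
theorem lintegral_lintegral_eq_shear {L M : Submodule ℝ (Euc n)} (h : Disjoint L M)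
    {G : Euc n → Euc n → ℝ≥0∞} (hG : Measurable (Function.uncurry G)) :
    ∫⁻ z, ∫⁻ z', G z z' = ENNReal.ofReal (subspaceDet L M) *
      ∫⁻ w : ((L ⊔ M)ᗮ : Submodule ℝ (Euc n)), ∫⁻ l : L, ∫⁻ l' : M, ∫⁻ m,
        G (m + (2⁻¹ : ℝ) • (w : Euc n) + l) (m - (2⁻¹ : ℝ) • (w : Euc n) + l') := by
  have hG' : Measurable (Function.uncurry fun v z' => G (v + z') z') :=
    hG.comp ((measurable_fst.add measurable_snd).prodMk measurable_snd)
  have h1 : ∫⁻ z, ∫⁻ z', G z z' = ∫⁻ v, ∫⁻ z', G (v + z') z' := by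
    rw [lintegral_lintegral_swap hG.aemeasurable, lintegral_lintegral_swap hG'.aemeasurable]
    refine lintegral_congr fun z' => ?_
    exact (lintegral_add_right_eq_self (fun z => G z z') z').symm
  rw [h1, lintegral_eq_subspaceDet_mul h hG'.lintegral_prod_right]
  congr 1
  refine lintegral_congr fun w => lintegral_congr fun l => lintegral_congr fun l' => ?_
  rw [← lintegral_add_right_eq_self _ (-((2⁻¹ : ℝ) • (w : Euc n)) + l')]
  refine lintegral_congr fun m => ?_
  congr 1
  · module
  · module

theorem lintegral_lintegral_pairWeight (e : EucSphere n) (δ : ℝ)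
    {s : Set (Euc n × ℝ × EucSphere n)} (hs : MeasurableSet s) (L : Gr n k₁) (M : Gr n k₂) :
    ∫⁻ z, ∫⁻ z', pairWeight e δ s (flatOf L z, flatOf M z') * (cylInd M z' * cylInd L z) =
      ballVol k₁ * ballVol k₂ * segIntegral e δ s L M := by
  by_cases h : Disjoint L.1 M.1
  swap
  · simp_rw [pairWeight_flatOf_of_not_disjoint e δ s h, segIntegral,
      subspaceDet_eq_zero_of_not_disjoint h]
    simp
  have hG : Measurable (Function.uncurry fun z z' =>
      pairWeight e δ s (flatOf L z, flatOf M z') * (cylInd M z' * cylInd L z)) :=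
    measurable_pairWeight_mul e δ hs measurable_const measurable_const measurable_fst measurable_snd
  rw [lintegral_lintegral_eq_shear h hG, segIntegral, mul_left_comm, ← lintegral_const_mul' _ _
    (ENNReal.mul_ne_top (ballVol_ne_top _) (ballVol_ne_top _))]
  congr 1
  refine lintegral_congr fun w => ?_
  have hw : (w : Euc n) ∈ L.1ᗮ ⊓ M.1ᗮ := by rw [Submodule.inf_orthogonal]; exact w.2
  have hwL : L.1.starProjection (w : Euc n) = 0 :=
    (Submodule.starProjection_apply_eq_zero_iff _).2 hw.1
  have hwM : M.1.starProjection (w : Euc n) = 0 :=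
    (Submodule.starProjection_apply_eq_zero_iff _).2 hw.2
  have key : ∀ (l : L.1) (l' : M.1) (m : Euc n),
      pairWeight e δ s (flatOf L (m + (2⁻¹ : ℝ) • (w : Euc n) + l),
        flatOf M (m - (2⁻¹ : ℝ) • (w : Euc n) + l')) *
        (cylInd M (m - (2⁻¹ : ℝ) • (w : Euc n) + l') *
          cylInd L (m + (2⁻¹ : ℝ) • (w : Euc n) + l)) =
      segKernel e δ s m w * (ballInd (M.1.starProjection (m + (l' : Euc n))) *
        ballInd (L.1.starProjection (m + (l : Euc n)))) := by
    intro l l' m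
    rw [pairWeight_flatOf e δ s h w.2 l.2 l'.2, cylInd, cylInd]
    simp only [map_add, map_sub, map_smul, hwL, hwM, smul_zero, add_zero, sub_zero]
  simp_rw [key]
  exact lintegral_mul_ballInd_mul_ballInd L.2 M.2
    (measurable_segKernel e δ hs measurable_id measurable_const)

/-- The integral over the varying space `(L + M)ᗮ` is measurable in `L` and `M` because it is a
multiple of an integral over the fixed space `ℝⁿ × ℝⁿ`. -/
theorem measurable_segIntegral (e : EucSphere n) (δ : ℝ) {s : Set (Euc n × ℝ × EucSphere n)}
    (hs : MeasurableSet s) :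
    Measurable fun p : Gr n k₁ × Gr n k₂ => segIntegral e δ s p.1 p.2 := by
  have hI : Measurable fun p : Gr n k₁ × Gr n k₂ => ∫⁻ z, ∫⁻ z',
      pairWeight e δ s (flatOf p.1 z, flatOf p.2 z') * (cylInd p.2 z' * cylInd p.1 z) := by
    have h := measurable_pairWeight_mul e δ hs
      (L := fun a : ((Gr n k₁ × Gr n k₂) × Euc n) × Euc n => a.1.1.1) (M := fun a => a.1.1.2)
      (z := fun a => a.1.2) (z' := fun a => a.2) (by fun_prop) (by fun_prop) (by fun_prop)
      (by fun_prop)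
    have h' := h.lintegral_prod_right' (ν := (volume : Measure (Euc n)))
    have h' := h'.lintegral_prod_right' (ν := (volume : Measure (Euc n)))
    exact h'
  have h0 : ballVol k₁ * ballVol k₂ ≠ 0 := mul_ne_zero (ballVol_ne_zero _) (ballVol_ne_zero _)
  have h1 : ballVol k₁ * ballVol k₂ ≠ ∞ :=
    ENNReal.mul_ne_top (ballVol_ne_top _) (ballVol_ne_top _)
  have h : ∀ p : Gr n k₁ × Gr n k₂, segIntegral e δ s p.1 p.2 = (ballVol k₁ * ballVol k₂)⁻¹ *
      ∫⁻ z, ∫⁻ z', pairWeight e δ s (flatOf p.1 z, flatOf p.2 z') *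
        (cylInd p.2 z' * cylInd p.1 z) := by
    intro p
    rw [lintegral_lintegral_pairWeight e δ hs, ← mul_assoc, ENNReal.inv_mul_cancel h0 h1, one_mul]
  simp_rw [h]
  exact hI.const_mul _

end

section

variable {n k₁ k₂ : ℕ} {Ω : Type*} [MeasurableSpace Ω] {P : Measure Ω}
  {X₁ : FlatProcess n k₁ P} {X₂ : FlatProcess n k₂ P}

instance (X : FlatProcess n k₁ P) : IsFiniteMeasure X.directionalDistribution := by
  rw [FlatProcess.directionalDistribution]
  infer_instance

/-- The intensity measure of the proximity process on an arbitrary measurable set `s`. All three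
parts of the final result are read off from this formula and from the behaviour of `segIntegral`
on rectangles, under translations and under rotations. -/
theorem proximityIntensity_eq (e : EucSphere n) (δ : ℝ)
    (hX₁ : X₁.IsWeaklyStationary) (hX₂ : X₂.IsWeaklyStationary)
    (hind : IndepFun X₁.randomMeasure X₂.randomMeasure P)
    {s : Set (Euc n × ℝ × EucSphere n)} (hs : MeasurableSet s) :
    proximityIntensity X₁ X₂ δ s = X₁.intensity * X₂.intensity *
      ∫⁻ L, ∫⁻ M, segIntegral e δ s L M ∂X₂.directionalDistribution
        ∂X₁.directionalDistribution := by
  have hW := measurable_pairWeight (k₁ := k₁) (k₂ := k₂) e δ hs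
  have hS := measurable_segIntegral (k₁ := k₁) (k₂ := k₂) e δ hs
  have h0 : ballVol k₁ * ballVol k₂ ≠ 0 := mul_ne_zero (ballVol_ne_zero _) (ballVol_ne_zero _)
  have h1 : ballVol k₁ * ballVol k₂ ≠ ∞ :=
    ENNReal.mul_ne_top (ballVol_ne_top _) (ballVol_ne_top _)
  refine (ENNReal.mul_right_inj h0 h1).1 ?_
  -- disintegrate the intensity measure of `X₂` for a fixed flat `E` of `X₁`
  have hin : ∀ E, ballVol k₂ * ∫⁻ F, pairWeight e δ s (E, F) ∂X₂.intensityMeasure =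
      X₂.intensity * ∫⁻ M, (∫⁻ z', pairWeight e δ s (E, flatOf M z') * cylInd M z')
        ∂X₂.directionalDistribution := fun E =>
    X₂.lintegral_intensityMeasure hX₂ (hW.comp (measurable_prodMk_left (x := E)))
  have hmJ : Measurable fun q : (Flat n k₁ × Gr n k₂) × Euc n =>
      pairWeight e δ s (q.1.1, flatOf q.1.2 q.2) * cylInd q.1.2 q.2 := by
    have h2 : Measurable fun q : (Flat n k₁ × Gr n k₂) × Euc n => q.1.2 := by fun_prop
    exact (measurable_pairWeight_comp e δ hs measurable_fst.fst
      (measurable_flatOf h2 measurable_snd)).fun_mul (measurable_cylInd h2 measurable_snd)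
  have hmJ' : Measurable fun E : Flat n k₁ => ∫⁻ M, (∫⁻ z', pairWeight e δ s (E, flatOf M z') *
      cylInd M z') ∂X₂.directionalDistribution :=
    hmJ.lintegral_prod_right'.lintegral_prod_right'
  rw [proximityIntensity_apply e δ hind hs, mul_assoc,
    ← lintegral_const_mul _ hW.lintegral_prod_right']
  simp_rw [hin]
  rw [X₁.lintegral_intensityMeasure hX₁ (hmJ'.const_mul _)]
  -- then that of `X₁`, for a fixed direction `L`
  have hout : ∀ L : Gr n k₁, ∫⁻ z, (X₂.intensity * ∫⁻ M, (∫⁻ z', pairWeight e δ s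
      (flatOf L z, flatOf M z') * cylInd M z') ∂X₂.directionalDistribution) * cylInd L z =
      X₂.intensity * (ballVol k₁ * ballVol k₂) *
        ∫⁻ M, segIntegral e δ s L M ∂X₂.directionalDistribution := by
    intro L
    have hJL : Measurable (Function.uncurry fun (z : Euc n) (M : Gr n k₂) =>
        ∫⁻ z', pairWeight e δ s (flatOf L z, flatOf M z') * (cylInd M z' * cylInd L z)) := by
      have h := measurable_pairWeight_mul e δ hs (L := fun _ : (Euc n × Gr n k₂) × Euc n => L)
        (M := fun a => a.1.2) (z := fun a => a.1.1) (z' := fun a => a.2) (by fun_prop)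
        (by fun_prop) (by fun_prop) (by fun_prop)
      have h' := h.lintegral_prod_right' (ν := (volume : Measure (Euc n)))
      exact h'
    have hstep : ∀ z, (X₂.intensity * ∫⁻ M, (∫⁻ z', pairWeight e δ s
        (flatOf L z, flatOf M z') * cylInd M z') ∂X₂.directionalDistribution) * cylInd L z =
        X₂.intensity * ∫⁻ M, (∫⁻ z', pairWeight e δ s (flatOf L z, flatOf M z') *
          (cylInd M z' * cylInd L z)) ∂X₂.directionalDistribution := by
      intro z
      have h1 : Measurable fun M : Gr n k₂ => ∫⁻ z', pairWeight e δ s (flatOf L z, flatOf M z') *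
          cylInd M z' := by
        have h := (hmJ.lintegral_prod_right' (ν := (volume : Measure (Euc n)))).comp
          (measurable_prodMk_left (x := flatOf L z))
        exact h
      rw [mul_assoc, ← lintegral_mul_const _ h1]
      congr 1
      refine lintegral_congr fun M => ?_
      have h2 : Measurable fun z' => pairWeight e δ s (flatOf L z, flatOf M z') * cylInd M z' := by
        exact (measurable_pairWeight_comp e δ hs measurable_const
          (measurable_flatOf measurable_const measurable_id)).fun_mul
            (measurable_cylInd measurable_const measurable_id)
      rw [← lintegral_mul_const _ h2]
      simp_rw [mul_assoc]
    simp_rw [hstep]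
    rw [lintegral_const_mul _ (hJL.lintegral_prod_right (ν := X₂.directionalDistribution)),
      lintegral_lintegral_swap hJL.aemeasurable]
    simp_rw [lintegral_lintegral_pairWeight e δ hs]
    have hSL : Measurable fun M : Gr n k₂ => segIntegral e δ s L M := by
      have h := hS.comp (measurable_prodMk_left (x := L))
      exact h
    rw [lintegral_const_mul _ hSL]
    ring
  simp_rw [hout]
  rw [lintegral_const_mul _ hS.lintegral_prod_right']
  ring

end

/-! ### Rotations, translations and rectangles -/

section

open Module (finrank)

variable {n k₁ k₂ : ℕ}

theorem lintegral_map_isometry (ρ : Euc n ≃ₗᵢ[ℝ] Euc n) {V W : Submodule ℝ (Euc n)}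
    (h : V.map (ρ.toLinearEquiv : Euc n →ₗ[ℝ] Euc n) = W) (g : Euc n → ℝ≥0∞) :
    ∫⁻ y : W, g y = ∫⁻ x : V, g (ρ x) := by
  subst h
  have hmp := (ρ.submoduleMap V).measurePreserving
  exact (hmp.lintegral_comp_emb
    (ρ.submoduleMap V).toHomeomorph.measurableEmbedding (fun y => g y)).symm

theorem map_orthogonal_sup (ρ : Euc n ≃ₗᵢ[ℝ] Euc n) (L M : Submodule ℝ (Euc n)) :
    (L ⊔ M)ᗮ.map (ρ.toLinearEquiv : Euc n →ₗ[ℝ] Euc n) =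
      (L.map (ρ.toLinearEquiv : Euc n →ₗ[ℝ] Euc n) ⊔
        M.map (ρ.toLinearEquiv : Euc n →ₗ[ℝ] Euc n))ᗮ := by
  rw [← Submodule.map_sup]
  exact Submodule.map_orthogonal_equiv _ ρ

theorem disjoint_rotate_iff (ρ : Euc n ≃ₗᵢ[ℝ] Euc n) (L : Gr n k₁) (M : Gr n k₂) :
    Disjoint (L.rotate ρ).1 (M.rotate ρ).1 ↔ Disjoint L.1 M.1 :=
  disjoint_map_orderIso_iff (f := Submodule.orderIsoMapComap ρ.toLinearEquiv)

theorem ballInd_map (ρ : Euc n ≃ₗᵢ[ℝ] Euc n) (x : Euc n) : ballInd (ρ x) = ballInd x := by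
  classical
  rw [ballInd, indicator_apply, indicator_apply]
  refine if_congr ?_ rfl rfl
  simp

/-- `[L, M]` is rotation invariant. It is defined with a chosen orthonormal basis of each subspace,
so the invariance is obtained from its characterization as the Jacobian of the decomposition
`ℝⁿ = (L + M)ᗮ ⊕ L ⊕ M`, applied to the unit ball. -/
theorem subspaceDet_rotate (ρ : Euc n ≃ₗᵢ[ℝ] Euc n) (L : Gr n k₁) (M : Gr n k₂) :
    ENNReal.ofReal (subspaceDet (L.rotate ρ).1 (M.rotate ρ).1) =
      ENNReal.ofReal (subspaceDet L.1 M.1) := by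
  by_cases h : Disjoint L.1 M.1
  swap
  · rw [subspaceDet_eq_zero_of_not_disjoint h,
      subspaceDet_eq_zero_of_not_disjoint (mt (disjoint_rotate_iff ρ L M).1 h)]
  have h1 := lintegral_eq_subspaceDet_mul h measurable_ballInd
  have h2 := lintegral_eq_subspaceDet_mul ((disjoint_rotate_iff ρ L M).2 h) measurable_ballInd
  have hU : (L.1 ⊔ M.1)ᗮ.map (ρ.toLinearEquiv : Euc n →ₗ[ℝ] Euc n) =
      ((L.rotate ρ).1 ⊔ (M.rotate ρ).1)ᗮ := map_orthogonal_sup ρ L.1 M.1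
  have h3 : ∫⁻ w : (((L.rotate ρ).1 ⊔ (M.rotate ρ).1)ᗮ : Submodule ℝ (Euc n)),
      ∫⁻ l : (L.rotate ρ).1, ∫⁻ m : (M.rotate ρ).1,
        ballInd ((w : Euc n) + (l : Euc n) - (m : Euc n)) =
      ∫⁻ w : ((L.1 ⊔ M.1)ᗮ : Submodule ℝ (Euc n)), ∫⁻ l : L.1, ∫⁻ m : M.1,
        ballInd ((w : Euc n) + (l : Euc n) - (m : Euc n)) := by
    rw [lintegral_map_isometry ρ hU (fun w : Euc n => ∫⁻ l : (L.rotate ρ).1,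
      ∫⁻ m : (M.rotate ρ).1, ballInd (w + (l : Euc n) - (m : Euc n)))]
    refine lintegral_congr fun w => ?_
    rw [lintegral_map_isometry ρ (V := L.1) (W := (L.rotate ρ).1) rfl
      (fun l : Euc n => ∫⁻ m : (M.rotate ρ).1,
        ballInd (ρ w + l - (m : Euc n)))]
    refine lintegral_congr fun l => ?_
    rw [lintegral_map_isometry ρ (V := M.1) (W := (M.rotate ρ).1) rfl
      (fun m : Euc n => ballInd (ρ w + ρ l - m))]
    refine lintegral_congr fun m => ?_
    rw [← map_add, ← map_sub, ballInd_map]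
  have hvol : ∫⁻ v : Euc n, ballInd v = ballVol n := by
    rw [ballInd, lintegral_indicator_one measurableSet_closedBall, ballVol]
  rw [h3, hvol] at h2
  rw [hvol] at h1
  set T := ∫⁻ w : ((L.1 ⊔ M.1)ᗮ : Submodule ℝ (Euc n)), ∫⁻ l : L.1, ∫⁻ m : M.1,
        ballInd ((w : Euc n) + (l : Euc n) - (m : Euc n))
  have hT0 : T ≠ 0 := fun h0 => ballVol_ne_zero n (by rw [h1, h0, mul_zero])
  have hT : T ≠ ∞ := by
    intro h0
    rw [h0] at h1
    by_cases hd : ENNReal.ofReal (subspaceDet L.1 M.1) = 0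
    · exact ballVol_ne_zero n (by rw [h1, hd, zero_mul])
    · exact ballVol_ne_top n (by rw [h1, ENNReal.mul_top hd])
  exact (ENNReal.mul_left_inj hT0 hT).1 (h2.symm.trans h1)

theorem unitVec_map (e : EucSphere n) (ρ : Euc n ≃ₗᵢ[ℝ] Euc n) {w : Euc n} (hw : w ≠ 0) :
    unitVec e (ρ w) = rotateSphere ρ (unitVec e w) := by
  ext1
  rw [coe_unitVec e (by simpa using hw), rotateSphere]
  simp only
  rw [coe_unitVec e hw, map_smul, ρ.norm_map]

theorem segKernel_rotate (e : EucSphere n) (δ : ℝ) (s : Set (Euc n × ℝ × EucSphere n))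
    (ρ : Euc n ≃ₗᵢ[ℝ] Euc n) (m w : Euc n) :
    segKernel e δ ((fun q => (q.1, q.2.1, rotateSphere ρ q.2.2)) ⁻¹' s) m w =
      segKernel e δ s m (ρ w) := by
  rw [segKernel, segKernel]
  by_cases h : 0 < ‖w‖ ∧ ‖w‖ ≤ δ
  swap
  · rw [indicator_of_notMem (by exact h), indicator_of_notMem]
    simpa only [mem_ofPred_eq, ρ.norm_map] using h
  have h' : 0 < ‖ρ w‖ ∧ ‖ρ w‖ ≤ δ := by simpa only [ρ.norm_map] using h
  rw [indicator_of_mem (s := {w : Euc n | 0 < ‖w‖ ∧ ‖w‖ ≤ δ}) h,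
    indicator_of_mem (s := {w : Euc n | 0 < ‖w‖ ∧ ‖w‖ ≤ δ}) h']
  have hw : w ≠ 0 := norm_pos_iff.1 h.1
  have hneg : rotateSphere ρ (-unitVec e w) = -rotateSphere ρ (unitVec e w) :=
    Subtype.ext (map_neg ρ _)
  rw [ρ.norm_map, unitVec_map e ρ hw, ← hneg]
  rfl

theorem segIntegral_rotate (e : EucSphere n) (δ : ℝ) (s : Set (Euc n × ℝ × EucSphere n))
    (ρ : Euc n ≃ₗᵢ[ℝ] Euc n) (L : Gr n k₁) (M : Gr n k₂) :
    segIntegral e δ ((fun q => (q.1, q.2.1, rotateSphere ρ q.2.2)) ⁻¹' s) L M =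
      segIntegral e δ s (L.rotate ρ) (M.rotate ρ) := by
  have hU : (L.1 ⊔ M.1)ᗮ.map (ρ.toLinearEquiv : Euc n →ₗ[ℝ] Euc n) =
      ((L.rotate ρ).1 ⊔ (M.rotate ρ).1)ᗮ := map_orthogonal_sup ρ L.1 M.1
  rw [segIntegral, segIntegral, subspaceDet_rotate,
    lintegral_map_isometry ρ hU (fun w => ∫⁻ m, segKernel e δ s m w)]
  simp_rw [segKernel_rotate]

theorem segIntegral_translate (e : EucSphere n) (δ : ℝ) (s : Set (Euc n × ℝ × EucSphere n))
    (z : Euc n) (L : Gr n k₁) (M : Gr n k₂) :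
    segIntegral e δ ((fun q => (q.1 + z, q.2)) ⁻¹' s) L M = segIntegral e δ s L M := by
  rw [segIntegral, segIntegral]
  congr 1
  refine lintegral_congr fun w => ?_
  exact lintegral_add_right_eq_self (fun m => segKernel e δ s m w) z

theorem lintegral_segKernel_prod (e : EucSphere n) {δ : ℝ} {A : Set (Euc n)} {B : Set ℝ}
    {C : Set (EucSphere n)} (hA : MeasurableSet A) (hBδ : B ⊆ Ioc 0 δ) (w : Euc n) :
    ∫⁻ m, segKernel e δ (A ×ˢ B ×ˢ C) m w = volume A * (2⁻¹ *
      ({w : Euc n | ‖w‖ ∈ B ∧ unitVec e w ∈ C}.indicator 1 w +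
        {w : Euc n | ‖w‖ ∈ B ∧ unitVec e w ∈ C}.indicator 1 (-w))) := by
  classical
  rw [← lintegral_indicator_one hA, ← lintegral_mul_const _ (measurable_one.indicator hA)]
  refine lintegral_congr fun m => ?_
  have hneg : ∀ h : w ≠ 0, unitVec e (-w) = -unitVec e w := fun h => by
    ext1
    have h' : ((-unitVec e w : EucSphere n) : Euc n) = -(unitVec e w : Euc n) := rfl
    rw [h', coe_unitVec e h, coe_unitVec e (neg_ne_zero.2 h), norm_neg, smul_neg]
  rw [segKernel]
  by_cases hw : 0 < ‖w‖ ∧ ‖w‖ ≤ δ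
  · rw [indicator_of_mem (by exact hw)]
    have h0 : w ≠ 0 := norm_pos_iff.1 hw.1
    by_cases hm : m ∈ A
    · simp only [indicator_apply, mem_prod, mem_ofPred_eq, hm, true_and, norm_neg, hneg h0,
        if_true, Pi.one_apply, one_mul]
    · simp [indicator_apply, hm]
  · rw [indicator_of_notMem (by exact hw)]
    have hB : ‖w‖ ∉ B := fun h => hw (hBδ h)
    simp [indicator_apply, hB]

/-- On a rectangle, the integral over the midpoint gives the volume of `A`, and polar coordinates in
the `(n - k₁ - k₂)`-dimensional space `(L + M)ᗮ` give the other two factors; the reflection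
`w ↦ -w` shows that `± w / ‖w‖` contribute equally. -/
theorem segIntegral_prod (e : EucSphere n) {δ : ℝ} {A : Set (Euc n)} {B : Set ℝ}
    {C : Set (EucSphere n)} (hA : MeasurableSet A) (hB : MeasurableSet B) (hBδ : B ⊆ Ioc 0 δ)
    (hC : MeasurableSet C) (L : Gr n k₁) (M : Gr n k₂) :
    segIntegral e δ (A ×ˢ B ×ˢ C) L M = volume A *
      (∫⁻ t in B, ENNReal.ofReal (t ^ (n - k₁ - k₂ - 1))) *
        (sphericalMeasure (L.1 ⊔ M.1)ᗮ C * ENNReal.ofReal (subspaceDet L.1 M.1)) := by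
  by_cases h : Disjoint L.1 M.1
  swap
  · rw [segIntegral, subspaceDet_eq_zero_of_not_disjoint h]
    simp
  have hdim : finrank ℝ (L.1 ⊔ M.1 : Submodule ℝ (Euc n))ᗮ = n - k₁ - k₂ := by
    have h1 := (L.1 ⊔ M.1).finrank_add_finrank_orthogonal
    rw [inGeneralPosition_iff_disjoint.2 h, finrank_euclideanSpace_fin] at h1
    omega
  set U := (L.1 ⊔ M.1)ᗮ
  have hS : MeasurableSet {w : Euc n | ‖w‖ ∈ B ∧ unitVec e w ∈ C} :=
    (measurable_norm hB).inter (measurable_unitVec e hC)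
  set S := {w : Euc n | ‖w‖ ∈ B ∧ unitVec e w ∈ C} with hS_def
  have h1 : Measurable fun w : U => S.indicator (1 : Euc n → ℝ≥0∞) w :=
    (measurable_one.indicator hS).comp measurable_subtype_coe
  have hV : ∫⁻ w : U, S.indicator (1 : Euc n → ℝ≥0∞) w =
      (∫⁻ t in B, ENNReal.ofReal (t ^ (n - k₁ - k₂ - 1))) * sphericalMeasure U C := by
    have h2 := volume_polar_rectangle e U hB (fun t ht => (hBδ ht).1) hC
    rw [hdim] at h2
    have h3 : MeasurableSet {w : U | ‖w‖ ∈ B ∧ unitVec e (w : Euc n) ∈ C} :=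
      measurable_subtype_coe hS
    rw [← h2, ← lintegral_indicator_one h3]
    rfl
  have hV' : ∫⁻ w : U, S.indicator (1 : Euc n → ℝ≥0∞) (-(w : Euc n)) =
      ∫⁻ w : U, S.indicator (1 : Euc n → ℝ≥0∞) w :=
    lintegral_neg_eq_self (μ := (volume : Measure U)) (fun w : U => S.indicator 1 (w : Euc n))
  have h1' : Measurable fun w : U => S.indicator (1 : Euc n → ℝ≥0∞) (-(w : Euc n)) :=
    (measurable_one.indicator hS).comp measurable_subtype_coe.neg
  rw [segIntegral]
  simp_rw [lintegral_segKernel_prod e hA hBδ]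
  change _ * ∫⁻ w : U, volume A * (2⁻¹ * (S.indicator (1 : Euc n → ℝ≥0∞) (w : Euc n) +
    S.indicator (1 : Euc n → ℝ≥0∞) (-(w : Euc n)))) = _
  rw [lintegral_const_mul _ ((h1.fun_add h1').const_mul _), lintegral_const_mul _ (h1.fun_add h1'),
    lintegral_add_left h1, hV', hV, ← two_mul, ← mul_assoc 2⁻¹ 2,
    ENNReal.inv_mul_cancel two_ne_zero ENNReal.ofNat_ne_top, one_mul]
  ring

theorem lintegral_pow_Ioc_ne_zero {δ : ℝ} (hδ : 0 < δ) (d : ℕ) :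
    ∫⁻ t in Ioc 0 δ, ENNReal.ofReal (t ^ d) ≠ 0 := by
  have hm : Measurable fun t : ℝ => ENNReal.ofReal (t ^ d) := by fun_prop
  refine ((setLIntegral_pos_iff hm).2 ?_).ne'
  have h : Ioc 0 δ ⊆ Function.support (fun t : ℝ => ENNReal.ofReal (t ^ d)) ∩ Ioc 0 δ := by
    intro t ht
    refine ⟨?_, ht⟩
    rw [Function.mem_support]
    exact (ENNReal.ofReal_pos.2 (pow_pos ht.1 d)).ne'
  refine lt_of_lt_of_le ?_ (measure_mono h)
  simpa using hδ

theorem lintegral_pow_Ioc_ne_top (δ : ℝ) (d : ℕ) :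
    ∫⁻ t in Ioc 0 δ, ENNReal.ofReal (t ^ d) ≠ ∞ := by
  refine (setLIntegral_lt_top_of_le_nnreal (by simp) ⟨(δ ^ d).toNNReal, fun t ht => ?_⟩).ne
  exact ENNReal.ofReal_le_ofReal (pow_le_pow_left₀ ht.1.le ht.2 d)

/-- The integrand of the rectangle formula is measurable: it is a multiple of `segIntegral` for the
product of the unit ball, the interval `(0, 1]` and `C`. -/
theorem measurable_sphericalMeasure_mul_subspaceDet (e : EucSphere n) {C : Set (EucSphere n)}
    (hC : MeasurableSet C) : Measurable fun p : Gr n k₁ × Gr n k₂ =>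
      sphericalMeasure (p.1.1 ⊔ p.2.1)ᗮ C * ENNReal.ofReal (subspaceDet p.1.1 p.2.1) := by
  set c := ballVol n * ∫⁻ t in Ioc (0 : ℝ) 1, ENNReal.ofReal (t ^ (n - k₁ - k₂ - 1))
  have hc0 : c ≠ 0 := mul_ne_zero (ballVol_ne_zero n) (lintegral_pow_Ioc_ne_zero one_pos _)
  have hc : c ≠ ∞ := ENNReal.mul_ne_top (ballVol_ne_top n) (lintegral_pow_Ioc_ne_top _ _)
  have h : ∀ p : Gr n k₁ × Gr n k₂,
      sphericalMeasure (p.1.1 ⊔ p.2.1)ᗮ C * ENNReal.ofReal (subspaceDet p.1.1 p.2.1) =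
      c⁻¹ * segIntegral e 1 (Metric.closedBall 0 1 ×ˢ Ioc 0 1 ×ˢ C) p.1 p.2 := by
    intro p
    rw [segIntegral_prod e measurableSet_closedBall measurableSet_Ioc subset_rfl hC, ← ballVol,
      ← mul_assoc, ENNReal.inv_mul_cancel hc0 hc, one_mul]
  simp_rw [h]
  exact (measurable_segIntegral e 1
    (measurableSet_closedBall.prod (measurableSet_Ioc.prod hC))).const_mul _

theorem measurable_rotateSphere (ρ : Euc n ≃ₗᵢ[ℝ] Euc n) : Measurable (rotateSphere ρ) :=
  (ρ.continuous.measurable.comp measurable_subtype_coe).subtype_mk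

end

/-! ### The intensity measure of the proximity process -/

theorem mainTheorem6 {Ω : Type*} [MeasurableSpace Ω] (P : Measure Ω) [IsProbabilityMeasure P]
    (n k₁ k₂ : ℕ) (hk₁ : 1 ≤ k₁) (hk₂ : 1 ≤ k₂) (hk : k₁ + k₂ < n) (δ : ℝ) (hδ : 0 < δ)
    (X₁ : FlatProcess n k₁ P) (X₂ : FlatProcess n k₂ P)
    (hX₁ : X₁.IsWeaklyStationary) (hX₂ : X₂.IsWeaklyStationary)
    (hind : IndepFun X₁.randomMeasure X₂.randomMeasure P) :
    Measurable (proximityProcess X₁ X₂ δ) ∧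
    (∀ (A : Set (Euc n)) (B : Set ℝ) (C : Set (EucSphere n)),
      MeasurableSet A → MeasurableSet B → B ⊆ Set.Ioc 0 δ → MeasurableSet C →
      proximityIntensity X₁ X₂ δ (A ×ˢ B ×ˢ C) =
        X₁.intensity * X₂.intensity * volume A *
          (∫⁻ t in B, ENNReal.ofReal (t ^ (n - k₁ - k₂ - 1))) *
          ∫⁻ L : Gr n k₁, ∫⁻ M : Gr n k₂,
            sphericalMeasure (L.1 ⊔ M.1)ᗮ C * ENNReal.ofReal (subspaceDet L.1 M.1)
            ∂X₂.directionalDistribution ∂X₁.directionalDistribution) ∧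
    (∀ z : Euc n, (proximityIntensity X₁ X₂ δ).map (fun q => (q.1 + z, q.2)) =
      proximityIntensity X₁ X₂ δ) ∧
    (IsRotationInvariant X₁.directionalDistribution →
      IsRotationInvariant X₂.directionalDistribution →
      ∀ ρ : Euc n ≃ₗᵢ[ℝ] Euc n, LinearMap.det (ρ.toLinearEquiv : Euc n →ₗ[ℝ] Euc n) = 1 →
        (proximityIntensity X₁ X₂ δ).map (fun q => (q.1, q.2.1, rotateSphere ρ q.2.2)) =
          proximityIntensity X₁ X₂ δ) := by
  -- the value of `unitVec e` at `0`, which does not enter the result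
  let e : EucSphere n := ⟨EuclideanSpace.single ⟨0, by omega⟩ 1, by simp⟩
  refine ⟨measurable_proximityProcess X₁ X₂ e δ, fun A B C hA hB hBδ hC => ?_, fun z => ?_,
    fun hQ₁ hQ₂ ρ hρ => ?_⟩
  · have hσ := measurable_sphericalMeasure_mul_subspaceDet (k₁ := k₁) (k₂ := k₂) e hC
    rw [proximityIntensity_eq e δ hX₁ hX₂ hind (hA.prod (hB.prod hC))]
    simp_rw [segIntegral_prod e hA hB hBδ hC]
    have h1 : ∀ L : Gr n k₁, ∫⁻ M : Gr n k₂, volume A *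
        (∫⁻ t in B, ENNReal.ofReal (t ^ (n - k₁ - k₂ - 1))) *
        (sphericalMeasure (L.1 ⊔ M.1)ᗮ C * ENNReal.ofReal (subspaceDet L.1 M.1))
          ∂X₂.directionalDistribution = volume A *
        (∫⁻ t in B, ENNReal.ofReal (t ^ (n - k₁ - k₂ - 1))) *
        ∫⁻ M : Gr n k₂, sphericalMeasure (L.1 ⊔ M.1)ᗮ C * ENNReal.ofReal (subspaceDet L.1 M.1)
          ∂X₂.directionalDistribution := fun L => by
      have h := hσ.comp (measurable_prodMk_left (x := L))
      exact lintegral_const_mul _ (by exact h)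
    simp_rw [h1]
    rw [lintegral_const_mul _ (hσ.lintegral_prod_right' (ν := X₂.directionalDistribution))]
    simp only [mul_assoc]
  · have hm : Measurable fun q : Euc n × ℝ × EucSphere n => (q.1 + z, q.2) := by fun_prop
    ext s hs
    rw [Measure.map_apply hm hs, proximityIntensity_eq e δ hX₁ hX₂ hind (hm hs),
      proximityIntensity_eq e δ hX₁ hX₂ hind hs]
    simp_rw [segIntegral_translate]
  · have hm : Measurable fun q : Euc n × ℝ × EucSphere n =>
        (q.1, q.2.1, rotateSphere ρ q.2.2) :=
      measurable_fst.prodMk (measurable_snd.fst.prodMk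
        ((measurable_rotateSphere ρ).comp measurable_snd.snd))
    ext s hs
    have hS := measurable_segIntegral (k₁ := k₁) (k₂ := k₂) e δ hs
    rw [Measure.map_apply hm hs, proximityIntensity_eq e δ hX₁ hX₂ hind (hm hs),
      proximityIntensity_eq e δ hX₁ hX₂ hind hs]
    congr 1
    simp_rw [segIntegral_rotate]
    have h2 : ∀ L : Gr n k₁, ∫⁻ M, segIntegral e δ s L (M.rotate ρ) ∂X₂.directionalDistribution =
        ∫⁻ M, segIntegral e δ s L M ∂X₂.directionalDistribution := by
      intro L
      have h := hS.comp (measurable_prodMk_left (x := L))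
      conv_rhs => rw [← hQ₂ ρ hρ]
      exact (lintegral_map h (Gr.continuous_rotate ρ).measurable).symm
    simp_rw [h2]
    conv_rhs => rw [← hQ₁ ρ hρ]
    exact (lintegral_map (hS.lintegral_prod_right' (ν := X₂.directionalDistribution))
      (Gr.continuous_rotate ρ).measurable).symm

end
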